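/- Let $\mathbb{R}^{2,1}$ be $\mathbb{R}^3$ with coordinates $(x,y,t)$ and the Lorentz metric $\langle\cdot,\cdot\rangle = dx^2+dy^2-dt^2$. A vector $v$ is spacelike if $\langle v,v\rangle>0$. A spacelike hypersurface is a connected smooth surface $M$ with a smooth immersion $F:M\to\mathbb{R}^{2,1}$ such that $dF(v)$ is spacelike for every nonzero tangent vector $v$ of $M$; it is complete if $M$, with the induced Riemannian metric, is complete (every sequence that is Cauchy for the Riemannian distance converges). Let $\gamma$ be a smooth (regular) simple closed curve in $\mathbb{R}^{2,1}$ that lies in (the image of) a complete spacelike hypersurface, and suppose that its curvature vector $\gamma''(s)$, where $s$ is the arc length of $\gamma$ for $\langle\cdot,\cdot\rangle$, is spacelike at every point. Let $T=\gamma'(s)$, $\kappa=\langle\gamma'',\gamma''\rangle^{1/2}$, $N=\gamma''/\kappa$, $B=T\times N$, where $\times$ is the Lorentzian cross product (the Euclidean one with the sign of the $t$ component changed), and let the torsion $\tau$ be defined by $N'=-\kappa T+\tau B$, that is, $\tau=-\langle N',B\rangle$. If $\tau\ge 0$ at every point of $\gamma$, or $\tau\le 0$ at every point of $\gamma$, then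 $\tau\equiv 0$ and $\gamma$ lies in a (two-dimensional affine) plane. -/

import Mathlib

open scoped Manifold ContDiff ENNReal

noncomputable section

namespace Minkowski

/-- The vector space underlying Minkowski space `ℝ^{2,1}`, with coordinates `(x, y, t)` indexed by
`0, 1, 2`. Only its linear, topological and smooth structures are used, never its Euclidean
metric. -/
abbrev R21 : Type := EuclideanSpace ℝ (Fin 3)

/-- The Lorentz metric `dx² + dy² - dt²`. -/
def lorentz (u v : R21) : ℝ := u 0 * v 0 + u 1 * v 1 - u 2 * v 2

/-- A vector is spacelike if the metric is positive on it. -/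
def IsSpacelike (v : R21) : Prop := 0 < lorentz v v

/-- The Lorentzian cross product: the usual one with the sign of the `t` component changed. -/
def cross (u v : R21) : R21 :=
  !₂[u 1 * v 2 - u 2 * v 1, u 2 * v 0 - u 0 * v 2, -(u 0 * v 1 - u 1 * v 0)]

section Curves

/-- `γ` is a regular parametrization of a smooth simple closed curve, of period `L`. -/
structure IsSmoothSimpleClosedCurve (γ : ℝ → R21) (L : ℝ) : Prop where
  period_pos : 0 < L
  smooth : ContDiff ℝ ∞ γ
  regular : ∀ t, deriv γ t ≠ 0
  periodic : Function.Periodic γ L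
  simple : Set.InjOn γ (Set.Ico 0 L)

/-- The speed `ds/dt` of a curve (with spacelike velocity), `s` being its arc length. -/
def speed (γ : ℝ → R21) (t : ℝ) : ℝ := √(lorentz (deriv γ t) (deriv γ t))

/-- The derivative `dX/ds`, with respect to the arc length `s` of `γ`, of a vector field `X`
along `γ`. -/
def arcDeriv (γ X : ℝ → R21) (t : ℝ) : R21 := (speed γ t)⁻¹ • deriv X t

/-- The unit tangent vector `T = dγ/ds`. -/
def tangent (γ : ℝ → R21) : ℝ → R21 := arcDeriv γ γ

/-- The curvature vector `dT/ds = d²γ/ds²`. -/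
def curvatureVector (γ : ℝ → R21) : ℝ → R21 := arcDeriv γ (tangent γ)

/-- The curvature, the length of the (spacelike) curvature vector. -/
def curvature (γ : ℝ → R21) (t : ℝ) : ℝ :=
  √(lorentz (curvatureVector γ t) (curvatureVector γ t))

/-- The unit normal `N`, so that `dT/ds = κ N`. -/
def normal (γ : ℝ → R21) (t : ℝ) : R21 := (curvature γ t)⁻¹ • curvatureVector γ t

/-- The binormal `B = T × N`, a timelike unit vector. -/
def binormal (γ : ℝ → R21) (t : ℝ) : R21 := cross (tangent γ t) (normal γ t)

/-- The torsion `τ`, the coefficient of `B` in the Frenet formula `dN/ds = -κ T + τ B`. The sign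
comes from `⟨B, B⟩ = -1`. -/
def torsion (γ : ℝ → R21) (t : ℝ) : ℝ := -lorentz (arcDeriv γ (normal γ) t) (binormal γ t)

end Curves

section Surfaces

variable {M : Type*} [TopologicalSpace M] [ChartedSpace (EuclideanSpace ℝ (Fin 2)) M]

/-- The differential of `F : M → ℝ^{2,1}` at `x`, applied to a tangent vector of the surface. -/
def pushforward (F : M → R21) (x : M) (v : TangentSpace (𝓡 2) x) : R21 :=
  mfderiv (𝓡 2) 𝓘(ℝ, R21) F x v

/-- `F` is a smooth map whose differential sends nonzero tangent vectors to spacelike vectors; in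
particular it is an immersion, and it presents `M` as a spacelike hypersurface. -/
structure IsSpacelikeImmersion (F : M → R21) : Prop where
  smooth : ContMDiff (𝓡 2) 𝓘(ℝ, R21) ∞ F
  spacelike : ∀ (x : M) (v : TangentSpace (𝓡 2) x), v ≠ 0 → IsSpacelike (pushforward F x v)

/-- The norm on the tangent spaces of `M` given by the induced metric. -/
@[reducible]
def inducedENorm (F : M → R21) (x : M) : ENorm (TangentSpace (𝓡 2) x) :=
  ⟨fun v => ENNReal.ofReal √(lorentz (pushforward F x v) (pushforward F x v))⟩

/-- The Riemannian distance of the induced metric: the infimum of the lengths of the `C¹` paths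
in `M` from `x` to `y`. -/
def inducedEDist (F : M → R21) (x y : M) : ℝ≥0∞ :=
  letI : ∀ z : M, ENorm (TangentSpace (𝓡 2) z) := inducedENorm F
  Manifold.riemannianEDist (𝓡 2) x y

/-- The induced metric is complete: every sequence that is Cauchy for the induced distance
converges in `M`. (The induced distance of an immersion as above induces the topology of `M`.) -/
def IsCompleteInduced (F : M → R21) : Prop :=
  ∀ u : ℕ → M,
    (∀ ε : ℝ≥0∞, 0 < ε → ∃ n₀ : ℕ, ∀ m ≥ n₀, ∀ n ≥ n₀, inducedEDist F (u m) (u n) < ε) →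
    ∃ a : M, Filter.Tendsto u Filter.atTop (nhds a)

end Surfaces

end Minkowski

end

/-!
A spacelike vector is at most as long as its shadow, its projection along the time axis onto the
plane `t = 0`. So the shadow map of the surface is a local diffeomorphism that does not shorten
curves, and by completeness every segment of the plane lifts to the surface; hence the shadow map is
injective, and the shadow of `γ` is a simple closed plane curve.

The binormal is timelike, so the shadow of `γ` has no inflection. By Hopf's Umlaufsatz its tangent
turns by exactly `±2π` in a period, which makes it strictly convex: it lies strictly on one side of
each of its tangents.

Fix a point `p = γ a`. The height over `p` of the osculating plane of `γ` at `γ t` has derivative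
`τ * area (p - γ t, γ' t) / B₂²`, where the area is that of the shadows and keeps a strict sign for
`a < t < a + L` by convexity. As this height takes the same value at `a` and at `a + L`, a torsion
of one sign vanishes on the whole period. Then `B` is constant, and `γ` lies in a plane orthogonal
to it.
-/

open Set Filter Topology NNReal

attribute [local instance] Complex.finrank_real_complex_fact

section ContinuousArgument

open Complex

/-- `θ` is a continuous choice on `s` of the argument of the complex-valued function `f`. -/
structure IsContinuousArgOn {X : Type*} [TopologicalSpace X] (f : X → ℂ) (θ : X → ℝ) (s : Set X) :
    Prop where
  continuousOn : ContinuousOn θ s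
  norm_mul_exp : ∀ x ∈ s, ‖f x‖ * exp (θ x * I) = f x

theorem exists_isContinuousArgOn_of_convex {E : Type*} [AddCommGroup E] [Module ℝ E]
    [TopologicalSpace E] [IsTopologicalAddGroup E] [ContinuousSMul ℝ E] [LocallyConvexSpace ℝ E]
    {f : E → ℂ} {s : Set E} (hs : Convex ℝ s) (hf : ContinuousOn f s) (hf0 : ∀ x ∈ s, f x ≠ 0) :
    ∃ θ, IsContinuousArgOn f θ s := by
  rcases s.eq_empty_or_nonempty with rfl | ⟨a, ha⟩
  · exact ⟨0, continuousOn_empty _, by simp⟩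
  have := hs.contractibleSpace ⟨a, ha⟩
  have := Convex.locallyPathConnectedSpace E hs
  obtain ⟨Λ, ⟨-, hΛ⟩, -⟩ := isCoveringMapOn_exp.existsUnique_continuousMap_lifts
    ⟨s.domRestrict f, hf.domRestrict⟩ (a₀ := ⟨a, ha⟩) (exp_log (hf0 a ha)) fun x => hf0 x x.2
  have hΛf : ∀ x : s, exp (Λ x) = f x := congrFun hΛ
  classical
  refine ⟨fun x => if hx : x ∈ s then (Λ ⟨x, hx⟩).im else 0, ?_, fun x hx => ?_⟩
  · rw [continuousOn_iff_continuous_domRestrict]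
    simpa [domRestrict_def, Function.comp_def] using continuous_im.comp Λ.continuous
  · rw [dif_pos hx, ← hΛf ⟨x, hx⟩, norm_exp, ofReal_exp, ← exp_add, re_add_im]

theorem eqOn_of_exp_mul_I_eq {X : Type*} [TopologicalSpace X] {s : Set X} (hs : IsPreconnected s)
    {δ : X → ℝ} (hδ : ContinuousOn δ s) {c : ℂ} (h : ∀ x ∈ s, exp (δ x * I) = c) {x y : X}
    (hx : x ∈ s) (hy : y ∈ s) : δ x = δ y := by
  have := isPreconnected_iff_preconnectedSpace.1 hs
  have hlift : (δ x * I : ℂ) = δ y * I :=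
    (T2Space.isSeparatedMap fun z : ℂ => (⟨_, z.exp_ne_zero⟩ : {z : ℂ // z ≠ 0})).const_of_comp
      isCoveringMap_exp.isLocalHomeomorph.isLocallyInjective
      ((continuous_ofReal.comp hδ.domRestrict).mul_const I)
      (fun a b => by simp [h]) ⟨x, hx⟩ ⟨y, hy⟩
  simpa using hlift

namespace IsContinuousArgOn

variable {X : Type*} [TopologicalSpace X] {f : X → ℂ} {θ : X → ℝ} {s : Set X}

theorem comp {Y : Type*} [TopologicalSpace Y] (hθ : IsContinuousArgOn f θ s) {g : Y → X}
    {t : Set Y} (hg : ContinuousOn g t) (hgt : MapsTo g t s) :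
    IsContinuousArgOn (f ∘ g) (θ ∘ g) t :=
  ⟨hθ.continuousOn.comp hg hgt, fun _ hy => hθ.norm_mul_exp _ (hgt hy)⟩

theorem im_eq (hθ : IsContinuousArgOn f θ s) {x : X} (hx : x ∈ s) :
    (f x).im = ‖f x‖ * Real.sin (θ x) := by
  conv_lhs => rw [← hθ.norm_mul_exp x hx, im_ofReal_mul, exp_ofReal_mul_I_im]

theorem areaForm_eq (hθ : IsContinuousArgOn f θ s) {x y : X} (hx : x ∈ s) (hy : y ∈ s) :
    Complex.orientation.areaForm (f x) (f y) = ‖f x‖ * ‖f y‖ * Real.sin (θ y - θ x) := by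
  conv_lhs => rw [← hθ.norm_mul_exp x hx, ← hθ.norm_mul_exp y hy]
  simp only [Complex.areaForm, mul_im, mul_re, map_mul, conj_re, conj_im, ofReal_re, ofReal_im,
    exp_ofReal_mul_I_re, exp_ofReal_mul_I_im, Real.sin_sub]
  ring

theorem exp_sub_eq (hθ : IsContinuousArgOn f θ s) {x y : X} (hx : x ∈ s) (hy : y ∈ s)
    (h0 : f x ≠ 0) (h : f y = -f x) : exp ((θ y - θ x : ℝ) * I) = -1 := by
  have hnorm : (‖f x‖ : ℂ) ≠ 0 := by simpa using h0
  have hexp : ‖f x‖ * exp (θ y * I) = -(‖f x‖ * exp (θ x * I)) := by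
    rw [hθ.norm_mul_exp x hx, ← h, ← norm_neg (f x), ← h, hθ.norm_mul_exp y hy]
  rw [← mul_neg] at hexp
  rw [ofReal_sub, sub_mul, exp_sub, mul_left_cancel₀ hnorm hexp, neg_div_self (exp_ne_zero _)]

theorem hasDerivAt {f : ℝ → ℂ} {θ : ℝ → ℝ} (hθ : IsContinuousArgOn f θ univ) {f' : ℂ} {t : ℝ}
    (hf : HasDerivAt f f' t) (h0 : f t ≠ 0) : HasDerivAt θ (f' / f t).im t := by
  have hθc := continuousOn_univ.1 hθ.continuousOn
  have hlog : HasDerivAt (fun s => log (f s / f t)) (f' / f t) t := by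
    simpa [h0] using (hf.div_const (f t)).clog_real (by simp [h0])
  have harg : HasDerivAt (fun s => (log (f s / f t)).im) (f' / f t).im t :=
    imCLM.hasFDerivAt.comp_hasDerivAt t hlog
  refine (harg.const_add (θ t)).congr_of_eventuallyEq ?_
  have hclose : Tendsto (fun s => θ s - θ t) (𝓝 t) (𝓝 0) := by
    simpa using (hθc.sub continuous_const).tendsto t (f := fun s => θ s - θ t)
  filter_upwards [hclose.eventually (Ioo_mem_nhds (neg_lt_zero.2 Real.pi_pos) Real.pi_pos),
    hf.continuousAt.eventually_ne h0] with s hs hs0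
  have hquot : f s / f t = (‖f s‖ / ‖f t‖ : ℝ) * exp ((θ s - θ t : ℝ) * I) := by
    rw [ofReal_sub, sub_mul, exp_sub, ofReal_div, div_mul_div_comm, hθ.norm_mul_exp _ trivial,
      hθ.norm_mul_exp _ trivial]
  have hpos : 0 < ‖f s‖ / ‖f t‖ := by positivity
  rw [log_im, hquot, exp_mul_I, arg_mul_cos_add_sin_mul_I hpos ⟨hs.1, hs.2.le⟩, add_sub_cancel]

end IsContinuousArgOn

end ContinuousArgument

section Chords

theorem injOn_Ico_of_periodic {X : Type*} {f : ℝ → X} {L a : ℝ} (hf : Function.Periodic f L)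
    (hL : 0 < L) (hinj : InjOn f (Ico a (a + L))) (b : ℝ) : InjOn f (Ico b (b + L)) := by
  intro s hs t ht hst
  have hmod : ∀ x, f (toIcoMod hL a x) = f x := fun x => by rw [toIcoMod, hf.sub_zsmul_eq]
  have ha : toIcoMod hL a s = toIcoMod hL a t :=
    hinj (toIcoMod_mem_Ico hL a s) (toIcoMod_mem_Ico hL a t) (by rw [hmod, hmod, hst])
  rw [← (toIcoMod_eq_self hL).2 hs, ← (toIcoMod_eq_self hL).2 ht]
  exact (toIcoMod_eq_toIcoMod hL).2 ((toIcoMod_eq_toIcoMod hL).1 ha)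

theorem periodic_deriv {E : Type*} [NormedAddCommGroup E] [NormedSpace ℝ E] {f : ℝ → E} {L : ℝ}
    (hf : Function.Periodic f L) : Function.Periodic (deriv f) L := fun x => by
  rw [← deriv_comp_add_const, funext hf]

/-- The mean velocity `(α t - α s) / (t - s)` of a curve between two parameters, which is the
velocity when they agree. -/
noncomputable def meanVelocity {E : Type*} [NormedAddCommGroup E] [NormedSpace ℝ E] (α : ℝ → E)
    (s t : ℝ) : E :=
  ∫ x in (0 : ℝ)..1, deriv α (s + x * (t - s))

/-- The direction of the chord of an `L`-periodic curve from `α s` to `α (s + r L)`, for `r` in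
`[0, 1]`: a positive multiple of `α (s + r L) - α s` for `0 < r < 1`, completed continuously by the
tangent directions `α' s` for `r = 0` and `-α' s` for `r = 1`. -/
noncomputable def chordDirection {E : Type*} [NormedAddCommGroup E] [NormedSpace ℝ E] (α : ℝ → E)
    (L : ℝ) (p : ℝ × ℝ) : E :=
  meanVelocity α p.1 (p.1 + p.2 * L) - meanVelocity α (p.1 + L) (p.1 + p.2 * L)

variable {E : Type*} [NormedAddCommGroup E] [NormedSpace ℝ E] {α : ℝ → E} {L : ℝ}

theorem meanVelocity_self [CompleteSpace E] (α : ℝ → E) (s : ℝ) :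
    meanVelocity α s s = deriv α s := by simp [meanVelocity]

theorem meanVelocity_comm (α : ℝ → E) (s t : ℝ) : meanVelocity α s t = meanVelocity α t s := by
  have h := intervalIntegral.integral_comp_sub_left
    (fun x : ℝ => deriv α (t + x * (s - t))) (a := 0) (b := 1) 1
  simp only [sub_self, sub_zero] at h
  rw [meanVelocity, meanVelocity, ← h]
  congr with x
  ring_nf

theorem meanVelocity_add_period (hper : Function.Periodic α L) (s t : ℝ) :
    meanVelocity α (s + L) (t + L) = meanVelocity α s t := by
  unfold meanVelocity
  congr with x
  rw [← periodic_deriv hper (s + x * (t - s))]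
  ring_nf

theorem smul_meanVelocity [CompleteSpace E] (hα : ContDiff ℝ 1 α) (s t : ℝ) :
    (t - s) • meanVelocity α s t = α t - α s := by
  have := hα.continuous_deriv le_rfl
  have h := intervalIntegral.integral_unitInterval_deriv_eq_sub (𝕜 := ℝ) (f := α) (f' := deriv α)
    (z₀ := s) (z₁ := t - s) (by fun_prop)
    (fun x _ => (hα.differentiable one_ne_zero _).hasDerivAt)
  simpa [meanVelocity] using h

theorem continuous_meanVelocity (hα : ContDiff ℝ 1 α) :
    Continuous fun p : ℝ × ℝ => meanVelocity α p.1 p.2 := by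
  have := hα.continuous_deriv le_rfl
  refine intervalIntegral.continuous_parametric_intervalIntegral_of_continuous' ?_ 0 1
  simp only [Function.uncurry_def]
  fun_prop

theorem chordDirection_reverse (hper : Function.Periodic α L) (s r : ℝ) :
    chordDirection α L (s + r * L, 1 - r) = -chordDirection α L (s, r) := by
  have h : s + r * L + (1 - r) * L = s + L := by ring
  rw [chordDirection, chordDirection, h, meanVelocity_add_period hper, neg_sub,
    meanVelocity_comm α (s + r * L), meanVelocity_comm α (s + r * L)]

theorem continuous_chordDirection (hα : ContDiff ℝ 1 α) (L : ℝ) :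
    Continuous (chordDirection α L) := by
  have h := continuous_meanVelocity hα
  exact (h.comp (f := fun p : ℝ × ℝ => (p.1, p.1 + p.2 * L)) (by fun_prop)).sub
    (h.comp (f := fun p : ℝ × ℝ => (p.1 + L, p.1 + p.2 * L)) (by fun_prop))

variable [CompleteSpace E]

theorem smul_chordDirection (hα : ContDiff ℝ 1 α) (hper : Function.Periodic α L) (s r : ℝ) :
    (r * (1 - r) * L) • chordDirection α L (s, r) = α (s + r * L) - α s := by
  have h₀ := smul_meanVelocity hα s (s + r * L)
  have h₁ := smul_meanVelocity hα (s + L) (s + r * L)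
  rw [hper s] at h₁
  calc (r * (1 - r) * L) • chordDirection α L (s, r)
      = (1 - r) • ((s + r * L - s) • meanVelocity α s (s + r * L))
        + r • ((s + r * L - (s + L)) • meanVelocity α (s + L) (s + r * L)) := by
        rw [chordDirection]; module
    _ = α (s + r * L) - α s := by rw [h₀, h₁]; module

theorem chordDirection_zero (hα : ContDiff ℝ 1 α) (hper : Function.Periodic α L) (hL : L ≠ 0)
    (s : ℝ) : chordDirection α L (s, 0) = deriv α s := by
  have h := smul_meanVelocity hα (s + L) s
  have hzero : meanVelocity α (s + L) s = 0 := by simpa [hper s, hL] using h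
  simp [chordDirection, hzero, meanVelocity_self]

theorem chordDirection_one (hα : ContDiff ℝ 1 α) (hper : Function.Periodic α L) (hL : L ≠ 0)
    (s : ℝ) : chordDirection α L (s, 1) = -deriv α s := by
  simpa [chordDirection_zero hα hper hL] using chordDirection_reverse hper s 0

theorem chordDirection_ne_zero (hα : ContDiff ℝ 1 α) (hper : Function.Periodic α L) (hL : 0 < L)
    (hinj : InjOn α (Ico 0 L)) (hreg : ∀ t, deriv α t ≠ 0) (s : ℝ) {r : ℝ}
    (hr : r ∈ Icc (0 : ℝ) 1) : chordDirection α L (s, r) ≠ 0 := by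
  rcases hr.1.eq_or_lt with rfl | h0
  · rw [chordDirection_zero hα hper hL.ne']
    exact hreg s
  rcases hr.2.eq_or_lt with rfl | h1
  · rw [chordDirection_one hα hper hL.ne']
    exact neg_ne_zero.2 (hreg s)
  intro h
  have heq := smul_chordDirection hα hper s r
  rw [h, smul_zero, eq_comm, sub_eq_zero] at heq
  have hinj' := injOn_Ico_of_periodic hper hL (a := 0) (by simpa using hinj) s
  have hend : s + r * L ∈ Ico s (s + L) := ⟨by nlinarith, by nlinarith⟩
  have := hinj' hend ⟨le_rfl, by linarith⟩ heq
  nlinarith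

end Chords

section Umlaufsatz

theorem abs_sub_lt_two_pi_of_sin_nonneg {a b : ℝ} (hab : a ≤ b) {θ : ℝ → ℝ}
    (hθ : ContinuousOn θ (Icc a b)) (h : ∀ r ∈ Icc a b, 0 ≤ Real.sin (θ r)) :
    |θ b - θ a| < 2 * Real.pi := by
  by_contra! hfar
  obtain ⟨k, hk, -⟩ := existsUnique_add_zsmul_mem_Ico Real.two_pi_pos (-(Real.pi / 2))
    (min (θ a) (θ b))
  have hmem : -(Real.pi / 2) + k • (2 * Real.pi) ∈ uIcc (θ a) (θ b) := by
    have := max_sub_min_eq_abs (θ a) (θ b)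
    exact ⟨hk.1, by linarith [hk.2]⟩
  rw [← uIcc_of_le hab] at hθ h
  obtain ⟨r, hr, hrk⟩ := intermediate_value_uIcc hθ hmem
  have hsin := h r hr
  rw [hrk, zsmul_eq_mul, Real.sin_add_int_mul_two_pi, Real.sin_neg, Real.sin_pi_div_two] at hsin
  linarith

theorem eq_pi_or_eq_neg_pi_of_cos_eq_neg_one {x : ℝ} (hcos : Real.cos x = -1)
    (hx : |x| < 2 * Real.pi) : x = Real.pi ∨ x = -Real.pi := by
  obtain ⟨k, rfl⟩ := Real.cos_eq_neg_one_iff.1 hcos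
  rw [abs_lt] at hx
  have hk₁ : -2 < k := by
    have : (-2 : ℝ) < k := by nlinarith [Real.pi_pos]
    exact_mod_cast this
  have hk₂ : k < 1 := by
    have : (k : ℝ) < 1 := by nlinarith [Real.pi_pos]
    exact_mod_cast this
  obtain rfl | rfl : k = 0 ∨ k = -1 := by omega
  · simp
  · right; push_cast; ring

variable {α : ℝ → ℂ} {L : ℝ}

theorem exists_forall_im_le_of_periodic (hα : Continuous α) (hper : Function.Periodic α L)
    (hL : 0 < L) : ∃ s₀, ∀ s, (α s₀).im ≤ (α s).im := by
  obtain ⟨s₀, -, hs₀⟩ := isCompact_Icc.exists_isMinOn (nonempty_Icc.2 hL.le)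
    (Complex.continuous_im.comp hα).continuousOn
  refine ⟨s₀, fun s => ?_⟩
  obtain ⟨y, hy, hys⟩ := hper.exists_mem_Ico₀ hL s
  rw [hys]
  exact hs₀ (Ico_subset_Icc_self hy)

theorem im_chordDirection_nonneg (hα : ContDiff ℝ 1 α) (hper : Function.Periodic α L) (hL : 0 < L)
    {s₀ : ℝ} (hs₀ : ∀ s, (α s₀).im ≤ (α s).im) {r : ℝ} (hr : r ∈ Icc (0 : ℝ) 1) :
    0 ≤ (chordDirection α L (s₀, r)).im := by
  have hhorizontal : (deriv α s₀).im = 0 :=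
    IsLocalMin.hasDerivAt_eq_zero (f := fun s => (α s).im) (.of_forall hs₀)
      (Complex.imCLM.hasFDerivAt.comp_hasDerivAt s₀
        (hα.differentiable one_ne_zero s₀).hasDerivAt)
  rcases hr.1.eq_or_lt with rfl | h0
  · rw [chordDirection_zero hα hper hL.ne', hhorizontal]
  rcases hr.2.eq_or_lt with rfl | h1
  · rw [chordDirection_one hα hper hL.ne', Complex.neg_im, hhorizontal, neg_zero]
  have him := congrArg Complex.im (smul_chordDirection hα hper s₀ r)
  rw [Complex.smul_im, Complex.sub_im, smul_eq_mul] at him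
  refine nonneg_of_mul_nonneg_right (a := r * (1 - r) * L) ?_
    (mul_pos (mul_pos h0 (sub_pos.2 h1)) hL)
  linarith [hs₀ (s₀ + r * L)]

/- Reversing the chord exchanges the motion of its endpoint around the curve with that of its
origin, and both motions turn it by the same angle `K`. -/
theorem exists_half_turn_of_chordDirection (hα : ContDiff ℝ 1 α) (hper : Function.Periodic α L)
    (hL : 0 < L) (hinj : InjOn α (Ico 0 L)) (hreg : ∀ t, deriv α t ≠ 0) {Θ : ℝ × ℝ → ℝ}
    (hΘ : IsContinuousArgOn (chordDirection α L) Θ (univ ×ˢ Icc 0 1)) :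
    ∃ K, Real.cos K = -1 ∧ ∀ s, Θ (s, 1) = Θ (s, 0) + K ∧ Θ (s + L, 0) = Θ (s, 1) + K := by
  have hrev : MapsTo (fun p : ℝ × ℝ => (p.1 + p.2 * L, 1 - p.2)) (univ ×ˢ Icc 0 1)
      (univ ×ˢ Icc 0 1) := fun p hp => ⟨trivial, by linarith [hp.2.2], by linarith [hp.2.1]⟩
  have hexp : ∀ p ∈ univ ×ˢ Icc (0 : ℝ) 1,
      Complex.exp ((Θ (p.1 + p.2 * L, 1 - p.2) - Θ p : ℝ) * Complex.I) = -1 := fun p hp =>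
    hΘ.exp_sub_eq hp (hrev hp) (chordDirection_ne_zero hα hper hL hinj hreg p.1 hp.2)
      (chordDirection_reverse hper p.1 p.2)
  have hconst : ∀ p ∈ univ ×ˢ Icc (0 : ℝ) 1,
      Θ (p.1 + p.2 * L, 1 - p.2) - Θ p = Θ (0, 1) - Θ (0, 0) := fun p hp => by
    simpa using eqOn_of_exp_mul_I_eq (isPreconnected_univ.prod isPreconnected_Icc)
      ((hΘ.continuousOn.comp (by fun_prop) hrev).sub hΘ.continuousOn) hexp hp
      (show ((0 : ℝ), (0 : ℝ)) ∈ _ by simp)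
  refine ⟨Θ (0, 1) - Θ (0, 0), ?_, fun s => ⟨?_, ?_⟩⟩
  · have hre := congrArg Complex.re (hexp (0, 0) (by simp))
    rw [Complex.exp_ofReal_mul_I_re] at hre
    simpa using hre
  · simpa [sub_eq_iff_eq_add'] using hconst (s, 0) (by simp)
  · simpa [sub_eq_iff_eq_add'] using hconst (s, 1) (by simp)

/- Hopf's Umlaufsatz. Seen from a lowest point of the curve, the chord never leaves a half plane, so
it turns by less than `2π` as its endpoint runs through the curve. -/
theorem exists_tangentAngle_add_period_eq (hα : ContDiff ℝ 1 α) (hper : Function.Periodic α L)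
    (hL : 0 < L) (hinj : InjOn α (Ico 0 L)) (hreg : ∀ t, deriv α t ≠ 0) :
    ∃ θ, IsContinuousArgOn (deriv α) θ univ ∧
      ((∀ s, θ (s + L) = θ s + 2 * Real.pi) ∨ ∀ s, θ (s + L) = θ s - 2 * Real.pi) := by
  have hV0 : ∀ p ∈ univ ×ˢ Icc (0 : ℝ) 1, chordDirection α L p ≠ 0 :=
    fun p hp => chordDirection_ne_zero hα hper hL hinj hreg p.1 hp.2
  obtain ⟨Θ, hΘ⟩ := exists_isContinuousArgOn_of_convex (convex_univ.prod (convex_Icc 0 1))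
    (continuous_chordDirection hα L).continuousOn hV0
  obtain ⟨K, hcosK, hK⟩ := exists_half_turn_of_chordDirection hα hper hL hinj hreg hΘ
  obtain ⟨s₀, hs₀⟩ := exists_forall_im_le_of_periodic hα.continuous hper hL
  have hupper : ∀ r ∈ Icc (0 : ℝ) 1, 0 ≤ Real.sin (Θ (s₀, r)) := fun r hr => by
    have hmem : (s₀, r) ∈ univ ×ˢ Icc (0 : ℝ) 1 := ⟨trivial, hr⟩
    have him := im_chordDirection_nonneg hα hper hL hs₀ hr
    rw [hΘ.im_eq hmem] at him
    exact nonneg_of_mul_nonneg_right him (norm_pos_iff.2 (hV0 _ hmem))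
  have hKlt : |K| < 2 * Real.pi := by
    have := abs_sub_lt_two_pi_of_sin_nonneg (θ := fun r => Θ (s₀, r)) zero_le_one
      (hΘ.continuousOn.comp (by fun_prop) fun r hr => ⟨trivial, hr⟩) hupper
    rwa [(hK s₀).1, add_sub_cancel_left] at this
  have htangent : IsContinuousArgOn (deriv α) (fun s => Θ (s, 0)) univ := by
    have hcomp := hΘ.comp (g := fun s => (s, 0)) (t := univ) (by fun_prop) fun s _ => by simp
    rwa [funext fun s => (chordDirection_zero hα hper hL.ne' s).symm]
  refine ⟨_, htangent, ?_⟩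
  rcases eq_pi_or_eq_neg_pi_of_cos_eq_neg_one hcosK hKlt with rfl | rfl
  · exact .inl fun s => by linarith [hK s]
  · exact .inr fun s => by linarith [hK s]

end Umlaufsatz

section Convexity

variable {α : ℝ → ℂ} {L : ℝ}

theorem areaForm_eq_normSq_mul_im_div (a b : ℂ) :
    Complex.orientation.areaForm a b = Complex.normSq a * (b / a).im := by
  rcases eq_or_ne a 0 with rfl | ha
  · simp
  · have : Complex.normSq a ≠ 0 := by simpa using ha
    rw [Complex.areaForm, Complex.div_im, Complex.mul_im, Complex.conj_re, Complex.conj_im]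
    field_simp
    ring

theorem areaForm_conj_conj (a b : ℂ) :
    Complex.orientation.areaForm (star a) (star b) = -Complex.orientation.areaForm a b := by
  simp [Complex.areaForm]; ring

theorem hasDerivAt_areaForm_sub {α' : ℂ} {x : ℝ} (h : HasDerivAt α α' x) (v c : ℂ) :
    HasDerivAt (fun x => Complex.orientation.areaForm v (α x - c))
      (Complex.orientation.areaForm v α') x :=
  (Complex.orientation.areaForm' v).hasFDerivAt.comp_hasDerivAt x (h.sub_const c)

theorem pos_of_hasDerivAt_pos_of_neg {f f' : ℝ → ℝ} (hf : ∀ x, HasDerivAt f (f' x) x)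
    {a b s : ℝ} (ha : f a = 0) (hb : f b = 0) (hs : s ∈ Ioo a b)
    (h : (∀ x ∈ Ioo a s, 0 < f' x) ∨ ∀ x ∈ Ioo s b, f' x < 0) : 0 < f s := by
  have hcont : Continuous f := continuous_iff_continuousAt.2 fun x => (hf x).continuousAt
  rcases h with hpos | hneg
  · have hmono : StrictMonoOn f (Icc a s) :=
      strictMonoOn_of_deriv_pos (convex_Icc a s) hcont.continuousOn fun x hx => by
        rw [(hf x).deriv]
        exact hpos x (by rwa [interior_Icc] at hx)
    exact ha ▸ hmono (left_mem_Icc.2 hs.1.le) (right_mem_Icc.2 hs.1.le) hs.1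
  · have hanti : StrictAntiOn f (Icc s b) :=
      strictAntiOn_of_deriv_neg (convex_Icc s b) hcont.continuousOn fun x hx => by
        rw [(hf x).deriv]
        exact hneg x (by rwa [interior_Icc] at hx)
    exact hb ▸ hanti (left_mem_Icc.2 hs.2.le) (right_mem_Icc.2 hs.2.le) hs.2

/- The tangent turns by `2π` over `[t, t + L]`, so the curve moves away from its tangent at `t` as
long as it has turned by at most `π`, and comes back to it afterwards. -/
theorem areaForm_deriv_sub_pos_of_tangentAngle (hα : Differentiable ℝ α)
    (hper : Function.Periodic α L) (hreg : ∀ t, deriv α t ≠ 0) {θ : ℝ → ℝ}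
    (hθ : IsContinuousArgOn (deriv α) θ univ) (hmono : StrictMono θ)
    (hθL : ∀ s, θ (s + L) = θ s + 2 * Real.pi) {t s : ℝ} (hs : s ∈ Ioo t (t + L)) :
    0 < Complex.orientation.areaForm (deriv α t) (α s - α t) := by
  have hderiv : ∀ x, HasDerivAt (fun x => Complex.orientation.areaForm (deriv α t) (α x - α t))
      (‖deriv α t‖ * ‖deriv α x‖ * Real.sin (θ x - θ t)) x := fun x => by
    rw [← hθ.areaForm_eq trivial trivial]
    exact hasDerivAt_areaForm_sub (hα x).hasDerivAt _ _
  have hnorm : ∀ x, 0 < ‖deriv α t‖ * ‖deriv α x‖ := fun x =>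
    mul_pos (norm_pos_iff.2 (hreg t)) (norm_pos_iff.2 (hreg x))
  refine pos_of_hasDerivAt_pos_of_neg hderiv (by simp) (by simp [hper t]) hs ?_
  rcases le_or_gt (θ s) (θ t + Real.pi) with hle | hgt
  · exact .inl fun x hx => mul_pos (hnorm x) <|
      Real.sin_pos_of_pos_of_lt_pi (by linarith [hmono hx.1]) (by linarith [hmono hx.2])
  · refine .inr fun x hx => mul_neg_of_pos_of_neg (hnorm x) ?_
    rw [← Real.sin_sub_two_pi]
    exact Real.sin_neg_of_neg_of_neg_pi_lt (by linarith [hmono hx.2, hθL t])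
      (by linarith [hmono hx.1])

theorem areaForm_deriv_sub_pos (hα : ContDiff ℝ 1 α) (hα' : Differentiable ℝ (deriv α))
    (hper : Function.Periodic α L) (hL : 0 < L) (hinj : InjOn α (Ico 0 L))
    (hcurv : ∀ t, 0 < Complex.orientation.areaForm (deriv α t) (deriv (deriv α) t)) {t s : ℝ}
    (hs : s ∈ Ioo t (t + L)) : 0 < Complex.orientation.areaForm (deriv α t) (α s - α t) := by
  have hreg : ∀ t, deriv α t ≠ 0 := fun t h => by simpa [h] using hcurv t
  obtain ⟨θ, hθ, hturn⟩ := exists_tangentAngle_add_period_eq hα hper hL hinj hreg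
  have hmono : StrictMono θ := strictMono_of_deriv_pos fun t => by
    rw [(hθ.hasDerivAt (hα' t).hasDerivAt (hreg t)).deriv]
    have := hcurv t
    rw [areaForm_eq_normSq_mul_im_div] at this
    exact pos_of_mul_pos_right this (Complex.normSq_nonneg _)
  have hθL : ∀ s, θ (s + L) = θ s + 2 * Real.pi := hturn.resolve_right fun h => by
    have := hmono (lt_add_of_pos_right 0 hL)
    linarith [h 0, Real.pi_pos]
  exact areaForm_deriv_sub_pos_of_tangentAngle (hα.differentiable one_ne_zero) hper hreg hθ hmono
    hθL hs

theorem forall_pos_or_forall_neg_of_ne_zero {X : Type*} [TopologicalSpace X] [PreconnectedSpace X]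
    {f : X → ℝ} (hf : Continuous f) (h0 : ∀ x, f x ≠ 0) : (∀ x, 0 < f x) ∨ ∀ x, f x < 0 := by
  by_contra! ⟨⟨x, hx⟩, ⟨y, hy⟩⟩
  obtain ⟨z, hz⟩ := mem_range_of_exists_le_of_exists_ge hf ⟨x, hx⟩ ⟨y, hy⟩
  exact h0 z hz

theorem areaForm_deriv_sub_pos_or_neg (hα : ContDiff ℝ 2 α)
    (hper : Function.Periodic α L) (hL : 0 < L) (hinj : InjOn α (Ico 0 L))
    (hcurv : ∀ t, Complex.orientation.areaForm (deriv α t) (deriv (deriv α) t) ≠ 0) :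
    (∀ t, ∀ s ∈ Ioo t (t + L), 0 < Complex.orientation.areaForm (deriv α t) (α s - α t)) ∨
      ∀ t, ∀ s ∈ Ioo t (t + L), Complex.orientation.areaForm (deriv α t) (α s - α t) < 0 := by
  have hα₁ : ContDiff ℝ 1 α := hα.of_le one_le_two
  have hα' : ContDiff ℝ 1 (deriv α) := ((contDiff_succ_iff_deriv (n := 1)).1 hα).2.2
  have hcont : Continuous fun t =>
      Complex.orientation.areaForm (deriv α t) (deriv (deriv α) t) := by
    have := hα'.continuous
    have := hα'.continuous_deriv le_rfl
    simp only [Complex.areaForm]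
    fun_prop
  refine (forall_pos_or_forall_neg_of_ne_zero hcont hcurv).imp
    (fun hpos t s => areaForm_deriv_sub_pos hα₁ (hα'.differentiable one_ne_zero) hper hL hinj hpos)
    fun hneg t s hs => ?_
  have hmirror := areaForm_deriv_sub_pos (α := fun t => star (α t))
    (Complex.conjCLE.contDiff.comp hα₁)
    (by simpa only [deriv.star'] using (hα'.differentiable one_ne_zero).star)
    (fun x => congrArg star (hper x)) hL (fun x hx y hy hxy => hinj hx hy (star_injective hxy))
    (fun x => by simpa only [deriv.star', areaForm_conj_conj, neg_pos] using hneg x) hs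
  simpa only [deriv.star', ← star_sub, areaForm_conj_conj, neg_pos] using hmirror

end Convexity

section WeightedRolle

theorem hasDerivAt_eq_zero_of_nonneg {f f' : ℝ → ℝ} (hf : ∀ t, HasDerivAt f (f' t) t) {a b : ℝ}
    (hab : f a = f b) (hnonneg : ∀ t ∈ Ioo a b, 0 ≤ f' t) {t : ℝ} (ht : t ∈ Ioo a b) :
    f' t = 0 := by
  have hle : a ≤ b := (ht.1.trans ht.2).le
  have hmono : MonotoneOn f (Icc a b) := monotoneOn_of_deriv_nonneg (convex_Icc a b)
    (fun x _ => (hf x).continuousAt.continuousWithinAt)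
    (fun x _ => (hf x).differentiableAt.differentiableWithinAt)
    (fun x hx => by rw [(hf x).deriv]; exact hnonneg x (by rwa [interior_Icc] at hx))
  have hconst : f =ᶠ[𝓝 t] fun _ => f a := by
    filter_upwards [Icc_mem_nhds ht.1 ht.2] with x hx
    refine le_antisymm ?_ (hmono (left_mem_Icc.2 hle) hx hx.1)
    rw [hab]
    exact hmono hx (right_mem_Icc.2 hle) hx.2
  exact (hf t).unique ((hasDerivAt_const t (f a)).congr_of_eventuallyEq hconst)

theorem eq_zero_of_hasDerivAt_mul {f g w : ℝ → ℝ} (hf : ∀ t, HasDerivAt f (g t * w t) t) {a b : ℝ}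
    (hab : f a = f b) (hg : (∀ t, 0 ≤ g t) ∨ ∀ t, g t ≤ 0)
    (hw : (∀ t ∈ Ioo a b, 0 < w t) ∨ ∀ t ∈ Ioo a b, w t < 0) {t : ℝ} (ht : t ∈ Ioo a b) :
    g t = 0 := by
  have hw0 : w t ≠ 0 := hw.elim (fun h => (h t ht).ne') fun h => (h t ht).ne
  have hsign : (∀ s ∈ Ioo a b, 0 ≤ g s * w s) ∨ ∀ s ∈ Ioo a b, 0 ≤ -(g s * w s) := by
    rcases hg with hg | hg <;> rcases hw with hw | hw
    · exact .inl fun s hs => mul_nonneg (hg s) (hw s hs).le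
    · exact .inr fun s hs => neg_nonneg.2 (mul_nonpos_of_nonneg_of_nonpos (hg s) (hw s hs).le)
    · exact .inr fun s hs => neg_nonneg.2 (mul_nonpos_of_nonpos_of_nonneg (hg s) (hw s hs).le)
    · exact .inl fun s hs => mul_nonneg_of_nonpos_of_nonpos (hg s) (hw s hs).le
  refine (mul_eq_zero.1 ?_).resolve_right hw0
  rcases hsign with hsign | hsign
  · exact hasDerivAt_eq_zero_of_nonneg hf hab hsign ht
  · exact neg_eq_zero.1
      (hasDerivAt_eq_zero_of_nonneg (fun s => (hf s).neg) (neg_inj.2 hab) hsign ht)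

end WeightedRolle

section InverseFunction

theorem isInvertible_of_injective {E G : Type*} [NormedAddCommGroup E] [NormedSpace ℝ E]
    [FiniteDimensional ℝ E] [NormedAddCommGroup G] [NormedSpace ℝ G] [FiniteDimensional ℝ G]
    {A : E →L[ℝ] G} (hA : Function.Injective A)
    (hdim : Module.finrank ℝ E = Module.finrank ℝ G) : A.IsInvertible :=
  ⟨(LinearEquiv.ofInjectiveOfFinrankEq A.toLinearMap hA hdim).toContinuousLinearEquiv, rfl⟩

variable {𝕜 E G M : Type*} [RCLike 𝕜] [NormedAddCommGroup E] [NormedSpace 𝕜 E]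
  [NormedAddCommGroup G] [NormedSpace 𝕜 G] {n : ℕ∞ω}

theorem isLocalDiffeomorphAt_of_isInvertible_fderiv [CompleteSpace E] {g : E → G} {U : Set E}
    {a : E} (hg : ContDiffOn 𝕜 n g U) (hU : IsOpen U) (ha : a ∈ U) (hn : n ≠ 0)
    (hinv : (fderiv 𝕜 g a).IsInvertible) : IsLocalDiffeomorphAt 𝓘(𝕜, E) 𝓘(𝕜, G) n g a := by
  have hgU : ∀ y ∈ U, ContDiffAt 𝕜 n g y := fun y hy => hg.contDiffAt (hU.mem_nhds hy)
  obtain ⟨A, hA⟩ := hinv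
  have hA' : HasFDerivAt g (A : E →L[𝕜] G) a :=
    hA ▸ ((hgU a ha).differentiableAt hn).hasFDerivAt
  let V : Set E := U ∩ fderiv 𝕜 g ⁻¹' range ((↑) : (E ≃L[𝕜] G) → E →L[𝕜] G)
  have hV : IsOpen V := (hg.continuousOn_fderiv_of_isOpen hU
    (ENat.one_le_iff_ne_zero_withTop.2 hn)).isOpen_inter_preimage hU ContinuousLinearEquiv.isOpen
  let e := ((hgU a ha).toOpenPartialHomeomorph g hA' hn).restrOpen V hV
  have hsource : e.source ⊆ V := fun y hy => hy.2
  have hsymm : ContDiffOn 𝕜 n e.symm e.target := fun y hy => by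
    obtain ⟨hyU, A', hA'⟩ := hsource (e.map_target hy)
    exact (e.contDiffAt_symm hy (f₀' := A')
      (hA' ▸ ((hgU _ hyU).differentiableAt hn).hasFDerivAt) (hgU _ hyU)).contDiffWithinAt
  exact ⟨⟨e.toPartialEquiv, e.open_source, e.open_target,
    (hg.mono fun y hy => (hsource hy).1).contMDiffOn, hsymm.contMDiffOn⟩,
    ⟨(hgU a ha).mem_toOpenPartialHomeomorph_source hA' hn, ha, A, hA⟩, fun _ _ => rfl⟩

variable [TopologicalSpace M] [ChartedSpace E M] [IsManifold 𝓘(𝕜, E) n M]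

theorem isLocalDiffeomorph_of_isInvertible_mfderiv [CompleteSpace E] {φ : M → G}
    (hφ : ContMDiff 𝓘(𝕜, E) 𝓘(𝕜, G) n φ) (hn : n ≠ 0)
    (hinv : ∀ x, (mfderiv 𝓘(𝕜, E) 𝓘(𝕜, G) φ x).IsInvertible) :
    IsLocalDiffeomorph 𝓘(𝕜, E) 𝓘(𝕜, G) n φ := by
  intro x
  set c := chartAt E x with hc
  have hxc : x ∈ c.source := mem_chart_source E x
  have hg : ContDiffOn 𝕜 n (φ ∘ c.symm) c.target :=
    (hφ.comp_contMDiffOn contMDiffOn_chart_symm).contDiffOn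
  have hfderiv : fderiv 𝕜 (φ ∘ c.symm) (c x) = mfderiv 𝓘(𝕜, E) 𝓘(𝕜, G) φ x := by
    rw [(hφ.mdifferentiable hn x).mfderiv]
    simp [writtenInExtChartAt, Function.comp_def, hc, chartAt_self_eq]
  let ψ : PartialDiffeomorph 𝓘(𝕜, E) 𝓘(𝕜, E) M E n :=
    ⟨c.toPartialEquiv, c.open_source, c.open_target, contMDiffOn_chart, contMDiffOn_chart_symm⟩
  obtain ⟨Φ, hcx, hΦ⟩ := isLocalDiffeomorphAt_of_isInvertible_fderiv hg c.open_target
    (c.map_source hxc) hn (hfderiv ▸ hinv x)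
  refine ⟨ψ.trans Φ, ⟨hxc, hcx⟩, fun y hy => ?_⟩
  calc φ y = (φ ∘ c.symm) (c y) := by rw [Function.comp_apply, c.left_inv hy.1]
    _ = Φ (c y) := hΦ hy.2

end InverseFunction

section Lifting

/-- `Γ` is a lift of the path `c` through `φ` over the set `s` of parameters. -/
structure IsLiftOn {M E : Type*} [TopologicalSpace M] (φ : M → E) (c : ℝ → E) (Γ : ℝ → M)
    (s : Set ℝ) : Prop where
  continuousOn : ContinuousOn Γ s
  map_eq : ∀ t ∈ s, φ (Γ t) = c t

namespace IsLiftOn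

variable {M E : Type*} [TopologicalSpace M] {φ : M → E} {c : ℝ → E} {Γ Γ' : ℝ → M} {s : Set ℝ}

theorem mono {s' : Set ℝ} (h : IsLiftOn φ c Γ s) (hs : s' ⊆ s) : IsLiftOn φ c Γ s' :=
  ⟨h.continuousOn.mono hs, fun t ht => h.map_eq t (hs ht)⟩

variable [TopologicalSpace E]

theorem eqOn [T2Space M] (hφ : IsLocalHomeomorph φ) (hs : IsPreconnected s)
    (h : IsLiftOn φ c Γ s) (h' : IsLiftOn φ c Γ' s) {a : ℝ} (ha : a ∈ s) (haa : Γ a = Γ' a) :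
    EqOn Γ Γ' s :=
  (T2Space.isSeparatedMap φ).eqOn_of_comp_eqOn hφ.isLocallyInjective hs h.continuousOn
    h'.continuousOn (fun t ht => (h.map_eq t ht).trans (h'.map_eq t ht).symm) ha haa

theorem exists_Ico [T2Space M] (hφ : IsLocalHomeomorph φ) {x₀ : M} {a b : ℝ}
    (hlift : ∀ t ∈ Ico a b, ∃ Γ, Γ a = x₀ ∧ IsLiftOn φ c Γ (Icc a t)) (hab : a < b) :
    ∃ Γ, Γ a = x₀ ∧ IsLiftOn φ c Γ (Ico a b) := by
  have : Nonempty M := ⟨x₀⟩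
  choose! G hGa hG using hlift
  have hdiag : ∀ t ∈ Ico a b, EqOn (fun s => G s s) (G t) (Icc a t) := fun t ht s hs =>
    have hs' : s ∈ Ico a b := ⟨hs.1, hs.2.trans_lt ht.2⟩
    (hG s hs').eqOn hφ isPreconnected_Icc ((hG t ht).mono (Icc_subset_Icc_right hs.2))
      ⟨le_rfl, hs.1⟩ ((hGa s hs').trans (hGa t ht).symm) ⟨hs.1, le_rfl⟩
  refine ⟨fun s => G s s, hGa a ⟨le_rfl, hab⟩, fun s hs => ?_,
    fun s hs => (hG s hs).map_eq s ⟨hs.1, le_rfl⟩⟩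
  obtain ⟨t, hst, htb⟩ := exists_between hs.2
  have ht : t ∈ Ico a b := ⟨hs.1.trans hst.le, htb⟩
  refine (((hG t ht).continuousOn.congr (hdiag t ht)) s ⟨hs.1, hst.le⟩).mono_of_mem_nhdsWithin ?_
  filter_upwards [self_mem_nhdsWithin, mem_nhdsWithin_of_mem_nhds (Iic_mem_nhds hst)] with r hr hrt
  exact ⟨hr.1, hrt⟩

theorem exists_Icc_of_mem_source {e : OpenPartialHomeomorph M E} (hc : Continuous c) {a t d : ℝ}
    (h : IsLiftOn e c Γ (Icc a t)) (hat : a ≤ t) (ht : Γ t ∈ e.source)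
    (hcd : MapsTo c (Icc t d) e.target) : ∃ Γ', Γ' a = Γ a ∧ IsLiftOn e c Γ' (Icc a d) := by
  have hglue : e.symm (c t) = Γ t := by rw [← h.map_eq t ⟨hat, le_rfl⟩, e.left_inv ht]
  refine ⟨fun s => if s ≤ t then Γ s else e.symm (c s), if_pos hat, ?_, fun s hs => ?_⟩
  · refine ContinuousOn.if ?_ (h.continuousOn.mono ?_) ?_
    · rintro s ⟨-, hs⟩
      rw [Iic_def, frontier_Iic] at hs
      rw [mem_singleton_iff.1 hs, hglue]
    · rintro s ⟨hs, hst⟩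
      rw [Iic_def, closure_Iic] at hst
      exact ⟨hs.1, hst⟩
    · refine e.continuousOn_symm.comp hc.continuousOn ?_
      rintro s ⟨hs, hst⟩
      simp only [not_le] at hst
      exact hcd ⟨closure_lt_subset_le continuous_const continuous_id hst, hs.2⟩
  · split_ifs with hst
    · exact h.map_eq s ⟨hs.1, hst⟩
    · exact e.right_inv (hcd ⟨(not_le.1 hst).le, hs.2⟩)

variable [T2Space E]

theorem map_eq_of_mapClusterPt (hφ : Continuous φ) (hc : Continuous c) {l : Filter ℝ} {b : ℝ}
    (hl : l ≤ 𝓝 b) (hlift : ∀ᶠ t in l, φ (Γ t) = c t) {x : M} (hx : MapClusterPt x l Γ) :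
    φ x = c b := by
  have hφc : Tendsto (φ ∘ Γ) l (𝓝 (c b)) :=
    ((hc.tendsto b).mono_left hl).congr' (hlift.mono fun t ht => ht.symm)
  exact eq_of_nhds_neBot ((hx.continuousAt_comp hφ.continuousAt).clusterPt.mono hφc)

theorem exists_Icc_of_mapClusterPt (hφ : IsLocalHomeomorph φ) (hc : Continuous c) {l : Filter ℝ}
    {a b : ℝ} (hl : l ≤ 𝓝 b) (hlift : ∀ᶠ t in l, a ≤ t ∧ IsLiftOn φ c Γ (Icc a t)) {x : M}
    (hx : MapClusterPt x l Γ) : ∃ d > b, ∃ Γ', Γ' a = Γ a ∧ IsLiftOn φ c Γ' (Icc a d) := by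
  have hφx : φ x = c b := map_eq_of_mapClusterPt hφ.continuous hc hl
    (hlift.mono fun t ht => ht.2.map_eq t ⟨ht.1, le_rfl⟩) hx
  obtain ⟨e, hxe, rfl⟩ := hφ x
  have hctarget : c ⁻¹' e.target ∈ 𝓝 b :=
    hc.continuousAt (e.open_target.mem_nhds (hφx ▸ e.map_source hxe))
  obtain ⟨δ, hδ, hball⟩ := Metric.nhds_basis_closedBall.mem_iff.1 hctarget
  rw [Real.closedBall_eq_Icc] at hball
  obtain ⟨t, ⟨hte, hat, ht⟩, htb⟩ := (((hx.frequently (e.open_source.mem_nhds hxe)).and_eventually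
    hlift).and_eventually (hl (Icc_mem_nhds (sub_lt_self b hδ) (lt_add_of_pos_right b hδ)))).exists
  exact ⟨b + δ, lt_add_of_pos_right b hδ, ht.exists_Icc_of_mem_source hc hat hte
    fun s hs => hball ⟨htb.1.trans hs.1, hs.2⟩⟩

theorem exists_Icc [T2Space M] (hφ : IsLocalHomeomorph φ) (hc : Continuous c) {a : ℝ} {x₀ : M}
    (hx₀ : φ x₀ = c a)
    (hcluster : ∀ Γ, ∀ b > a, IsLiftOn φ c Γ (Ico a b) → ∃ x, MapClusterPt x (𝓝[<] b) Γ) (b : ℝ) :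
    ∃ Γ, Γ a = x₀ ∧ IsLiftOn φ c Γ (Icc a b) := by
  by_contra hb
  let S : Set ℝ := {t | ∃ Γ, Γ a = x₀ ∧ IsLiftOn φ c Γ (Icc a t)}
  have hSdown : ∀ t ∈ S, ∀ t' ≤ t, t' ∈ S := fun t ⟨Γ, hΓa, hΓ⟩ t' htt' =>
    ⟨Γ, hΓa, hΓ.mono (Icc_subset_Icc_right htt')⟩
  have hSbdd : BddAbove S := ⟨b, fun t ht => le_of_not_ge fun hbt => hb (hSdown t ht b hbt)⟩
  have haS : IsLiftOn φ c (fun _ => x₀) (Icc a a) :=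
    ⟨continuousOn_const, fun t ht => by rw [hx₀, le_antisymm ht.2 ht.1]⟩
  have hSne : S.Nonempty := ⟨a, _, rfl, haS⟩
  have hlt : a < sSup S := by
    obtain ⟨d, hd, hdS⟩ := exists_Icc_of_mapClusterPt hφ hc (pure_le_nhds a)
      (eventually_pure.2 ⟨le_rfl, haS⟩) (tendsto_pure_nhds _ a).mapClusterPt
    exact hd.trans_le (le_csSup hSbdd hdS)
  have hSIco : ∀ t ∈ Ico a (sSup S), t ∈ S := fun t ht => by
    obtain ⟨t', ht', htt'⟩ := exists_lt_of_lt_csSup hSne ht.2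
    exact hSdown t' ht' t htt'.le
  obtain ⟨Γ, hΓa, hΓ⟩ := exists_Ico hφ hSIco hlt
  obtain ⟨x, hx⟩ := hcluster Γ _ hlt hΓ
  obtain ⟨d, hd, Γ', hΓ'a, hΓ'⟩ := exists_Icc_of_mapClusterPt hφ hc nhdsWithin_le_nhds (by
    filter_upwards [Ioo_mem_nhdsLT hlt] with t ht
    exact ⟨ht.1.le, hΓ.mono (Icc_subset_Ico_right ht.2)⟩) hx
  exact hd.not_ge (le_csSup hSbdd ⟨Γ', hΓ'a.trans hΓa, hΓ'⟩)

end IsLiftOn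

end Lifting

section Injectivity

variable {M E : Type*} [TopologicalSpace M] [T2Space M] {φ : M → E}

theorem injective_of_continuous_rightInverse [PreconnectedSpace M] [TopologicalSpace E]
    [Nonempty E] (hφ : IsLocalHomeomorph φ) {σ : E → M} (hσ : Continuous σ)
    (hright : Function.RightInverse σ φ) : Function.Injective φ := by
  have hσlocal : IsLocalHomeomorph σ := .of_comp
    (hright.comp_eq_id ▸ (Homeomorph.refl E).isLocalHomeomorph) hφ hσ
  have hrange : range σ = {x | σ (φ x) = x} :=
    Subset.antisymm (range_subset_iff.2 fun v => congrArg σ (hright v)) fun x hx => ⟨φ x, hx⟩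
  have hclopen : IsClopen (range σ) :=
    ⟨hrange ▸ isClosed_eq (hσ.comp hφ.continuous) continuous_id, hσlocal.isOpenMap.isOpen_range⟩
  have hleft : Function.LeftInverse σ φ := fun x =>
    hrange.subset (hclopen.eq_univ (range_nonempty σ) ▸ mem_univ x)
  exact hleft.injective

theorem injective_of_segment_lift [PreconnectedSpace M] [NormedAddCommGroup E] [NormedSpace ℝ E]
    (hφ : IsLocalHomeomorph φ) (x₀ : M)
    (hlift : ∀ v : E, ∃ Γ, Γ 0 = x₀ ∧ IsLiftOn φ (fun t => φ x₀ + t • v) Γ (Icc 0 1)) :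
    Function.Injective φ := by
  choose Γ hΓ0 hΓ using hlift
  let segment : C(unitInterval × E, E) := ⟨fun p => φ x₀ + (p.1 : ℝ) • p.2, by fun_prop⟩
  let lift : unitInterval × E → M := fun p => Γ p.2 p.1
  have hlift : Continuous lift := by
    refine hφ.continuous_lift (T2Space.isSeparatedMap φ) segment
      (funext fun p => (hΓ p.2).map_eq p.1 p.1.2) ?_ fun v => (hΓ v).continuousOn.domRestrict
    exact continuous_const.congr fun v => (hΓ0 v).symm
  refine injective_of_continuous_rightInverse hφ (σ := fun p => lift (1, p - φ x₀))
    (hlift.comp (by fun_prop)) fun p => ?_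
  simpa [lift] using (hΓ (p - φ x₀)).map_eq 1 ⟨zero_le_one, le_rfl⟩

end Injectivity

section SmoothLift

variable {E G M : Type*} [NormedAddCommGroup E] [NormedSpace ℝ E] [NormedAddCommGroup G]
  [NormedSpace ℝ G] [TopologicalSpace M] [ChartedSpace E M] {n : ℕ∞ω}

theorem IsLiftOn.contMDiffOn {φ : M → G} (hφ : IsLocalDiffeomorph 𝓘(ℝ, E) 𝓘(ℝ, G) n φ)
    {c : ℝ → G} {Γ : ℝ → M} {s : Set ℝ} (h : IsLiftOn φ c Γ s) (hc : ContDiffOn ℝ n c s) :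
    ContMDiffOn 𝓘(ℝ, ℝ) 𝓘(ℝ, E) n Γ s := by
  intro t ht
  obtain ⟨Φ, hx, hΦ⟩ := hφ (Γ t)
  have hsymm : ContMDiffAt 𝓘(ℝ, G) 𝓘(ℝ, E) n Φ.symm (c t) :=
    Φ.symm.contMDiffOn.contMDiffAt <| Φ.open_target.mem_nhds <| by
      rw [← h.map_eq t ht, hΦ hx]
      exact Φ.map_source hx
  refine (hsymm.comp_contMDiffWithinAt t (hc t ht).contMDiffWithinAt).congr_of_eventuallyEq_of_mem
    ?_ ht
  filter_upwards [self_mem_nhdsWithin, h.continuousOn t ht (Φ.open_source.mem_nhds hx)]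
    with r hr hrΦ
  rw [Function.comp_apply, ← h.map_eq r hr, hΦ hrΦ]
  exact (Φ.left_inv hrΦ).symm

end SmoothLift

noncomputable section

namespace Minkowski

section Algebra

/-- The projection of `ℝ^{2,1}` along the time axis onto the plane `t = 0`, which is identified
with `ℂ`. -/
def shadow : R21 →L[ℝ] ℂ :=
  (EuclideanSpace.proj 0 : R21 →L[ℝ] ℝ).smulRight 1 +
    (EuclideanSpace.proj 1 : R21 →L[ℝ] ℝ).smulRight Complex.I

@[simp] theorem shadow_re (v : R21) : (shadow v).re = v 0 := by simp [shadow]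

@[simp] theorem shadow_im (v : R21) : (shadow v).im = v 1 := by simp [shadow]

theorem lorentz_self_eq (v : R21) : lorentz v v = ‖shadow v‖ ^ 2 - v 2 ^ 2 := by
  rw [Complex.sq_norm, Complex.normSq_apply, shadow_re, shadow_im, lorentz, sq]

theorem sqrt_lorentz_le_norm_shadow (v : R21) : √(lorentz v v) ≤ ‖shadow v‖ :=
  Real.sqrt_le_iff.2 ⟨norm_nonneg _, by rw [lorentz_self_eq]; linarith [sq_nonneg (v 2)]⟩

theorem IsSpacelike.shadow_ne_zero {v : R21} (hv : IsSpacelike v) : shadow v ≠ 0 := fun h =>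
  (Real.sqrt_pos.2 hv).not_ge (by simpa [h] using sqrt_lorentz_le_norm_shadow v)

/-- The Lorentz metric `lorentz` as a continuous bilinear form. -/
def lorentzL : R21 →L[ℝ] R21 →L[ℝ] ℝ :=
  (LinearMap.mk₂ ℝ lorentz (fun _ _ _ => by simp [lorentz]; ring)
    (fun _ _ _ => by simp [lorentz]; ring) (fun _ _ _ => by simp [lorentz]; ring)
    (fun _ _ _ => by simp [lorentz]; ring)).toContinuousBilinearMap

/-- The Lorentzian cross product `cross` as a continuous bilinear map. -/
def crossL : R21 →L[ℝ] R21 →L[ℝ] R21 :=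
  (LinearMap.mk₂ ℝ cross
    (fun _ _ _ => by ext i; fin_cases i <;> simp [cross] <;> ring)
    (fun _ _ _ => by ext i; fin_cases i <;> simp [cross] <;> ring)
    (fun _ _ _ => by ext i; fin_cases i <;> simp [cross] <;> ring)
    (fun _ _ _ => by ext i; fin_cases i <;> simp [cross] <;> ring)).toContinuousBilinearMap

theorem lorentzL_apply (u v : R21) : lorentzL u v = lorentz u v := rfl

theorem crossL_apply (u v : R21) : crossL u v = cross u v := rfl

theorem lorentz_comm (u v : R21) : lorentz u v = lorentz v u := by
  simp only [lorentz]; ring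

theorem lorentz_smul_left (c : ℝ) (u v : R21) : lorentz (c • u) v = c * lorentz u v := by
  simp [← lorentzL_apply]

theorem lorentz_smul_right (c : ℝ) (u v : R21) : lorentz u (c • v) = c * lorentz u v := by
  simp [← lorentzL_apply]

theorem lorentz_inv_smul_self {c : ℝ} (hc : 0 < c) {u : R21} (hu : lorentz u u = c ^ 2) :
    lorentz (c⁻¹ • u) (c⁻¹ • u) = 1 := by
  rw [lorentz_smul_left, lorentz_smul_right, hu]
  field_simp

theorem cross_self (u : R21) : cross u u = 0 := by
  ext i; fin_cases i <;> simp [cross] <;> ring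

theorem lorentz_cross_left (u v : R21) : lorentz (cross u v) u = 0 := by
  simp [lorentz, cross]; ring

theorem lorentz_cross_cross (u v : R21) :
    lorentz (cross u v) (cross u v) = lorentz u v ^ 2 - lorentz u u * lorentz v v := by
  simp [lorentz, cross]; ring

theorem cross_cross_left (u v : R21) :
    cross u (cross u v) = lorentz u u • v - lorentz u v • u := by
  ext i; fin_cases i <;> simp [cross, lorentz] <;> ring

theorem cross_cross_right (u v : R21) :
    cross v (cross u v) = lorentz u v • v - lorentz v v • u := by
  ext i; fin_cases i <;> simp [cross, lorentz] <;> ring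

/- The expansion of `w` in the frame `u`, `v`, `u × v`, with the Gram determinant of `u`, `v` as
common denominator. -/
theorem gram_smul_eq (u v w : R21) :
    (lorentz u u * lorentz v v - lorentz u v ^ 2) • w =
      (lorentz w u * lorentz v v - lorentz w v * lorentz u v) • u +
        (lorentz w v * lorentz u u - lorentz w u * lorentz u v) • v -
          lorentz w (cross u v) • cross u v := by
  ext i; fin_cases i <;> simp [cross, lorentz] <;> ring

theorem areaForm_shadow_shadow (u v : R21) :
    Complex.orientation.areaForm (shadow u) (shadow v) = -cross u v 2 := by
  simp [Complex.areaForm, cross]; ring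

theorem lorentz_mul_cross_sub (b n w : R21) :
    lorentz n w * b 2 - lorentz b w * n 2 =
      -Complex.orientation.areaForm (shadow w) (shadow (cross n b)) := by
  simp [Complex.areaForm, cross, lorentz]; ring

theorem hasDerivAt_lorentz {X Y : ℝ → R21} {X' Y' : R21} {t : ℝ} (hX : HasDerivAt X X' t)
    (hY : HasDerivAt Y Y' t) :
    HasDerivAt (fun t => lorentz (X t) (Y t)) (lorentz (X t) Y' + lorentz X' (Y t)) t :=
  lorentzL.hasDerivAt_of_bilinear (fun _ => hX) fun _ => hY

theorem hasDerivAt_cross {X Y : ℝ → R21} {X' Y' : R21} {t : ℝ} (hX : HasDerivAt X X' t)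
    (hY : HasDerivAt Y Y' t) :
    HasDerivAt (fun t => cross (X t) (Y t)) (cross (X t) Y' + cross X' (Y t)) t :=
  crossL.hasDerivAt_of_bilinear (fun _ => hX) fun _ => hY

theorem contDiff_sqrt_lorentz_self {X : ℝ → R21} {n : WithTop ℕ∞} (hX : ContDiff ℝ n X)
    (h : ∀ t, IsSpacelike (X t)) : ContDiff ℝ n fun t => √(lorentz (X t) (X t)) :=
  (lorentzL.isBoundedBilinearMap.contDiff.comp (hX.prodMk hX)).sqrt fun t => (h t).ne'

theorem exists_plane_of_lorentz_eq {X : Type*} {γ : X → R21} {b : R21} (hb : lorentz b b ≠ 0)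
    {c : ℝ} (h : ∀ t, lorentz b (γ t) = c) :
    ∃ P : AffineSubspace ℝ R21, Module.finrank ℝ P.direction = 2 ∧ ∀ t, γ t ∈ P := by
  have hsurj : Function.Surjective (lorentzL b : R21 →ₗ[ℝ] ℝ) :=
    LinearMap.surjective fun h0 => hb (DFunLike.congr_fun h0 b)
  refine ⟨AffineSubspace.mk' ((c / lorentz b b) • b) (lorentzL b : R21 →ₗ[ℝ] ℝ).ker, ?_,
    fun t => ?_⟩
  · have hrank := (lorentzL b : R21 →ₗ[ℝ] ℝ).finrank_range_add_finrank_ker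
    rw [LinearMap.range_eq_top.2 hsurj, finrank_top, Module.finrank_self,
      finrank_euclideanSpace_fin] at hrank
    rw [AffineSubspace.direction_mk']
    omega
  · rw [AffineSubspace.mem_mk', LinearMap.mem_ker, vsub_eq_sub, map_sub, sub_eq_zero]
    exact (h t).trans (by rw [map_smul]; exact (div_mul_cancel₀ c hb).symm)

end Algebra

section Surfaces

variable {M : Type*} [TopologicalSpace M] [ChartedSpace (EuclideanSpace ℝ (Fin 2)) M] {F : M → R21}

theorem mfderiv_shadow_comp {x : M} (hF : MDifferentiableAt (𝓡 2) 𝓘(ℝ, R21) F x)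
    (v : TangentSpace (𝓡 2) x) :
    mfderiv (𝓡 2) 𝓘(ℝ, ℂ) (shadow ∘ F) x v = shadow (pushforward F x v) := by
  rw [mfderiv_comp x shadow.mdifferentiableAt hF, shadow.mfderiv_eq]
  rfl

/-- The `C¹` version of `IsSpacelikeImmersion`, which suffices for the geometry of the shadow. -/
structure IsC1SpacelikeImmersion (F : M → R21) : Prop where
  contMDiff : ContMDiff (𝓡 2) 𝓘(ℝ, R21) 1 F
  spacelike : ∀ (x : M) (v : TangentSpace (𝓡 2) x), v ≠ 0 → IsSpacelike (pushforward F x v)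

theorem IsC1SpacelikeImmersion.mdifferentiableAt (hF : IsC1SpacelikeImmersion F) (x : M) :
    MDifferentiableAt (𝓡 2) 𝓘(ℝ, R21) F x :=
  hF.contMDiff.mdifferentiable one_ne_zero x

theorem IsC1SpacelikeImmersion.isLocalDiffeomorph_shadow_comp [IsManifold (𝓡 2) 1 M]
    (hF : IsC1SpacelikeImmersion F) :
    IsLocalDiffeomorph (𝓡 2) 𝓘(ℝ, ℂ) 1 (shadow ∘ F) := by
  refine isLocalDiffeomorph_of_isInvertible_mfderiv (shadow.contMDiff.comp hF.contMDiff) one_ne_zero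
    fun x => ?_
  refine isInvertible_of_injective (E := EuclideanSpace ℝ (Fin 2)) (G := ℂ)
    ((injective_iff_map_eq_zero _).2 fun v hv => ?_) (by simp)
  by_contra hv0
  exact (hF.spacelike x v hv0).shadow_ne_zero
    ((mfderiv_shadow_comp (hF.mdifferentiableAt x) v).symm.trans hv)

theorem enormSMulClass_inducedENorm (F : M → R21) (x : M) :
    letI := inducedENorm F x
    ENormSMulClass ℝ (TangentSpace (𝓡 2) x) := by
  let _ := inducedENorm F x
  refine ⟨fun r v => ?_⟩
  change ENNReal.ofReal √(lorentz (pushforward F x (r • v)) (pushforward F x (r • v))) =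
    ‖r‖ₑ * ENNReal.ofReal √(lorentz (pushforward F x v) (pushforward F x v))
  have hmap : pushforward F x (r • v) = r • pushforward F x v :=
    (mfderiv (𝓡 2) 𝓘(ℝ, R21) F x).map_smul r v
  rw [hmap, lorentz_smul_left, lorentz_smul_right, ← mul_assoc, Real.sqrt_mul (mul_self_nonneg r),
    Real.sqrt_mul_self_eq_abs, ENNReal.ofReal_mul (abs_nonneg r), Real.enorm_eq_ofReal_abs]

theorem inducedEDist_comm (F : M → R21) (x y : M) : inducedEDist F x y = inducedEDist F y x := by
  let _ : ∀ z : M, ENorm (TangentSpace (𝓡 2) z) := inducedENorm F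
  have := enormSMulClass_inducedENorm F
  exact Manifold.riemannianEDist_comm

variable {Γ : ℝ → M} {c : ℝ → ℂ} {C : ℝ≥0}

theorem mfderiv_shadow_comp_lift {t : ℝ} (hF : MDifferentiableAt (𝓡 2) 𝓘(ℝ, R21) F (Γ t))
    (hΓ : MDifferentiableAt 𝓘(ℝ, ℝ) (𝓡 2) Γ t) (hlift : shadow ∘ F ∘ Γ =ᶠ[𝓝 t] c) :
    shadow (pushforward F (Γ t) (mfderiv 𝓘(ℝ, ℝ) (𝓡 2) Γ t 1)) = deriv c t := by
  rw [← mfderiv_shadow_comp hF, ← hlift.deriv_eq, ← fderiv_apply_one_eq_deriv, ← mfderiv_eq_fderiv,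
    ← Function.comp_assoc, mfderiv_comp t (shadow.mdifferentiableAt.comp _ hF) hΓ]
  rfl

theorem IsC1SpacelikeImmersion.inducedEDist_lift_le_of_le [IsManifold (𝓡 2) 1 M]
    (hF : IsC1SpacelikeImmersion F) (hc : ContDiff ℝ 1 c) (hC : ∀ t, ‖deriv c t‖ₑ ≤ C)
    {a b : ℝ} (hab : a ≤ b) (hΓ : IsLiftOn (shadow ∘ F) c Γ (Icc a b)) :
    inducedEDist F (Γ a) (Γ b) ≤ C * edist a b := by
  have hΓsmooth : ContMDiffOn 𝓘(ℝ, ℝ) (𝓡 2) 1 Γ (Icc a b) :=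
    hΓ.contMDiffOn hF.isLocalDiffeomorph_shadow_comp hc.contDiffOn
  let _ : ∀ z : M, ENorm (TangentSpace (𝓡 2) z) := inducedENorm F
  have := enormSMulClass_inducedENorm F
  have hspeed : ∀ t ∈ Ioo a b, ‖mfderiv 𝓘(ℝ, ℝ) (𝓡 2) Γ t 1‖ₑ ≤ C := by
    intro t ht
    have hIcc : Icc a b ∈ 𝓝 t := Icc_mem_nhds ht.1 ht.2
    have hderiv := mfderiv_shadow_comp_lift (c := c) (hF.mdifferentiableAt (Γ t))
      ((hΓsmooth.contMDiffAt hIcc).mdifferentiableAt one_ne_zero)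
      (eventually_of_mem hIcc hΓ.map_eq)
    refine (ENNReal.ofReal_le_ofReal (sqrt_lorentz_le_norm_shadow _)).trans ?_
    rw [hderiv, ofReal_norm]
    exact hC t
  calc inducedEDist F (Γ a) (Γ b) ≤ Manifold.pathELength (𝓡 2) Γ a b :=
      Manifold.riemannianEDist_le_pathELength hΓsmooth rfl rfl hab
    _ = ∫⁻ t in Ioo a b, ‖mfderiv 𝓘(ℝ, ℝ) (𝓡 2) Γ t 1‖ₑ :=
      Manifold.pathELength_eq_lintegral_mfderiv_Ioo
    _ ≤ ∫⁻ _ in Ioo a b, C := MeasureTheory.setLIntegral_mono measurable_const hspeed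
    _ = C * edist a b := by
      rw [MeasureTheory.setLIntegral_const, Real.volume_Ioo, edist_comm, edist_dist, Real.dist_eq,
        abs_of_nonneg (sub_nonneg.2 hab)]

theorem IsC1SpacelikeImmersion.inducedEDist_lift_le [IsManifold (𝓡 2) 1 M]
    (hF : IsC1SpacelikeImmersion F) (hc : ContDiff ℝ 1 c) (hC : ∀ t, ‖deriv c t‖ₑ ≤ C)
    {S : Set ℝ} (hS : S.OrdConnected) (hΓ : IsLiftOn (shadow ∘ F) c Γ S) {a b : ℝ} (ha : a ∈ S)
    (hb : b ∈ S) : inducedEDist F (Γ a) (Γ b) ≤ C * edist a b := by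
  rcases le_total a b with hab | hba
  · exact hF.inducedEDist_lift_le_of_le hc hC hab (hΓ.mono (hS.out ha hb))
  · rw [inducedEDist_comm, edist_comm]
    exact hF.inducedEDist_lift_le_of_le hc hC hba (hΓ.mono (hS.out hb ha))

theorem IsC1SpacelikeImmersion.exists_mapClusterPt_of_isLiftOn [IsManifold (𝓡 2) 1 M]
    (hF : IsC1SpacelikeImmersion F) (hcomplete : IsCompleteInduced F)
    (hc : ContDiff ℝ 1 c) (hC : ∀ t, ‖deriv c t‖ₑ ≤ C) {a b : ℝ} (hab : a < b)
    (hΓ : IsLiftOn (shadow ∘ F) c Γ (Ico a b)) : ∃ x, MapClusterPt x (𝓝[<] b) Γ := by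
  obtain ⟨t, -, htmem, ht⟩ := exists_seq_strictMono_tendsto' hab
  have htIco : ∀ n, t n ∈ Ico a b := fun n => Ioo_subset_Ico_self (htmem n)
  obtain ⟨x, hx⟩ := hcomplete (Γ ∘ t) fun ε hε => by
    obtain ⟨N, hN⟩ := EMetric.cauchySeq_iff.1 ht.cauchySeq (ε / C)
      (ENNReal.div_pos hε.ne' ENNReal.coe_ne_top)
    exact ⟨N, fun m hm n hn =>
      (hF.inducedEDist_lift_le hc hC ordConnected_Ico hΓ (htIco m) (htIco n)).trans_lt
        (ENNReal.mul_lt_of_lt_div' (hN m hm n hn))⟩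
  have ht' : Tendsto t atTop (𝓝[<] b) :=
    tendsto_nhdsWithin_iff.2 ⟨ht, .of_forall fun n => (htmem n).2⟩
  exact ⟨x, hx.mapClusterPt.of_comp ht'⟩

theorem IsC1SpacelikeImmersion.injective_shadow_comp [PreconnectedSpace M] [T2Space M]
    [IsManifold (𝓡 2) 1 M] (hF : IsC1SpacelikeImmersion F) (hcomplete : IsCompleteInduced F) :
    Function.Injective (shadow ∘ F) := by
  have hlocal := hF.isLocalDiffeomorph_shadow_comp.isLocalHomeomorph
  refine fun x y hxy => injective_of_segment_lift hlocal x (fun v => ?_) hxy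
  have hderiv : ∀ t, deriv (fun t : ℝ => (shadow ∘ F) x + t • v) t = v := fun t =>
    (((hasDerivAt_id t).smul_const v).const_add _).deriv.trans (one_smul ℝ v)
  exact IsLiftOn.exists_Icc hlocal (by fun_prop) (by simp) (fun Γ b hb hΓ =>
    hF.exists_mapClusterPt_of_isLiftOn (C := ‖v‖₊) hcomplete (by fun_prop)
      (fun t => by rw [hderiv]; rfl) hb hΓ) 1

end Surfaces

section Frenet

/-- The (signed) height, along the time axis, over the point `p`, of the osculating plane of `γ`
at `γ t`. -/
def osculatingHeight (γ : ℝ → R21) (p : R21) (t : ℝ) : ℝ :=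
  lorentz (binormal γ t) (p - γ t) / binormal γ t 2

variable {γ : ℝ → R21}

theorem periodic_arcDeriv {X : ℝ → R21} {L : ℝ} (hγ : Function.Periodic γ L)
    (hX : Function.Periodic X L) : Function.Periodic (arcDeriv γ X) L := fun t => by
  simp only [arcDeriv, speed, periodic_deriv hγ t, periodic_deriv hX t]

theorem periodic_binormal {L : ℝ} (hγ : Function.Periodic γ L) :
    Function.Periodic (binormal γ) L := fun t => by
  have hT : Function.Periodic (tangent γ) L := periodic_arcDeriv hγ hγ
  have hK : Function.Periodic (curvatureVector γ) L := periodic_arcDeriv hγ hT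
  simp only [binormal, normal, curvature, hT t, hK t]

theorem speed_pos_of_isSpacelike_curvatureVector {t : ℝ}
    (h : IsSpacelike (curvatureVector γ t)) : 0 < speed γ t := by
  refine (Real.sqrt_nonneg _).lt_of_ne' fun h0 => ?_
  have hK : curvatureVector γ t = 0 := by
    rw [curvatureVector, arcDeriv, speed, h0, inv_zero, zero_smul]
  simp [hK, IsSpacelike, lorentz] at h

theorem isSpacelike_deriv_of_isSpacelike_curvatureVector {t : ℝ}
    (h : IsSpacelike (curvatureVector γ t)) : IsSpacelike (deriv γ t) :=
  Real.sqrt_pos.1 (speed_pos_of_isSpacelike_curvatureVector h)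

theorem deriv_eq_speed_smul_arcDeriv {t : ℝ} (h : 0 < speed γ t) (X : ℝ → R21) :
    deriv X t = speed γ t • arcDeriv γ X t := (smul_inv_smul₀ h.ne' _).symm

theorem lorentz_tangent_tangent {t : ℝ} (h : IsSpacelike (deriv γ t)) :
    lorentz (tangent γ t) (tangent γ t) = 1 :=
  lorentz_inv_smul_self (Real.sqrt_pos.2 h) (Real.sq_sqrt h.le).symm

theorem lorentz_normal_normal {t : ℝ} (h : IsSpacelike (curvatureVector γ t)) :
    lorentz (normal γ t) (normal γ t) = 1 :=
  lorentz_inv_smul_self (Real.sqrt_pos.2 h) (Real.sq_sqrt h.le).symm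

theorem curvatureVector_eq_smul_normal {t : ℝ} (h : IsSpacelike (curvatureVector γ t)) :
    curvatureVector γ t = curvature γ t • normal γ t :=
  (smul_inv_smul₀ (Real.sqrt_pos.2 h).ne' _).symm

theorem deriv_tangent {t : ℝ} (h : IsSpacelike (curvatureVector γ t)) :
    deriv (tangent γ) t = (speed γ t * curvature γ t) • normal γ t := by
  rw [mul_smul, ← curvatureVector_eq_smul_normal h]
  exact deriv_eq_speed_smul_arcDeriv (speed_pos_of_isSpacelike_curvatureVector h) _

theorem lorentz_binormal_deriv {t : ℝ} (h : 0 < speed γ t) :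
    lorentz (binormal γ t) (deriv γ t) = 0 := by
  rw [deriv_eq_speed_smul_arcDeriv h, lorentz_smul_right, binormal]
  exact mul_eq_zero_of_right _ (lorentz_cross_left _ _)

theorem contDiff_speed {n : WithTop ℕ∞} (hγ : ContDiff ℝ (n + 1) γ)
    (hv : ∀ t, IsSpacelike (deriv γ t)) : ContDiff ℝ n (speed γ) :=
  contDiff_sqrt_lorentz_self hγ.deriv' hv

theorem contDiff_arcDeriv {n : WithTop ℕ∞} {X : ℝ → R21} (hγ : ContDiff ℝ (n + 1) γ)
    (hv : ∀ t, IsSpacelike (deriv γ t)) (hX : ContDiff ℝ (n + 1) X) :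
    ContDiff ℝ n (arcDeriv γ X) :=
  ((contDiff_speed hγ hv).inv fun t => (Real.sqrt_pos.2 (hv t)).ne').smul hX.deriv'

theorem contDiff_normal {n : WithTop ℕ∞} (hγ : ContDiff ℝ (n + 1 + 1) γ)
    (hcurv : ∀ t, IsSpacelike (curvatureVector γ t)) : ContDiff ℝ n (normal γ) := by
  have hv := fun t => isSpacelike_deriv_of_isSpacelike_curvatureVector (hcurv t)
  have hK : ContDiff ℝ n (curvatureVector γ) :=
    contDiff_arcDeriv (hγ.of_le le_self_add) hv (contDiff_arcDeriv hγ hv hγ)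
  exact ((contDiff_sqrt_lorentz_self hK hcurv).inv fun t => (Real.sqrt_pos.2 (hcurv t)).ne').smul hK

section

variable (hγ : ContDiff ℝ 2 γ) (hcurv : ∀ t, IsSpacelike (curvatureVector γ t))
include hγ hcurv

theorem hasDerivAt_tangent (t : ℝ) :
    HasDerivAt (tangent γ) ((speed γ t * curvature γ t) • normal γ t) t := by
  have hT : ContDiff ℝ 1 (tangent γ) := contDiff_arcDeriv hγ
    (fun t => isSpacelike_deriv_of_isSpacelike_curvatureVector (hcurv t)) hγ
  rw [← deriv_tangent (hcurv t)]
  exact (hT.differentiable one_ne_zero t).hasDerivAt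

theorem lorentz_tangent_normal (t : ℝ) : lorentz (tangent γ t) (normal γ t) = 0 := by
  have hv := speed_pos_of_isSpacelike_curvatureVector (hcurv t)
  have hunit : (fun t => lorentz (tangent γ t) (tangent γ t)) = fun _ => 1 := funext fun t =>
    lorentz_tangent_tangent (isSpacelike_deriv_of_isSpacelike_curvatureVector (hcurv t))
  have hT := hasDerivAt_tangent hγ hcurv t
  have hderiv := (hunit ▸ hasDerivAt_lorentz hT hT).unique (hasDerivAt_const t 1)
  rw [lorentz_comm (_ • _), ← two_mul, lorentz_smul_right] at hderiv
  have hκ : 0 < curvature γ t := Real.sqrt_pos.2 (hcurv t)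
  exact (mul_eq_zero.1 ((mul_eq_zero.1 hderiv).resolve_left two_ne_zero)).resolve_left
    (mul_pos hv hκ).ne'

theorem lorentz_binormal_binormal (t : ℝ) : lorentz (binormal γ t) (binormal γ t) = -1 := by
  rw [binormal, lorentz_cross_cross, lorentz_tangent_normal hγ hcurv,
    lorentz_normal_normal (hcurv t), lorentz_tangent_tangent
      (isSpacelike_deriv_of_isSpacelike_curvatureVector (hcurv t))]
  norm_num

theorem binormal_time_ne_zero (t : ℝ) : binormal γ t 2 ≠ 0 := fun h => by
  have hB := lorentz_binormal_binormal hγ hcurv t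
  rw [lorentz_self_eq, h] at hB
  nlinarith [sq_nonneg ‖shadow (binormal γ t)‖]

theorem cross_tangent_binormal (t : ℝ) : cross (tangent γ t) (binormal γ t) = normal γ t := by
  rw [binormal, cross_cross_left, lorentz_tangent_normal hγ hcurv, lorentz_tangent_tangent
    (isSpacelike_deriv_of_isSpacelike_curvatureVector (hcurv t)), one_smul, zero_smul, sub_zero]

theorem cross_normal_binormal (t : ℝ) : cross (normal γ t) (binormal γ t) = -tangent γ t := by
  rw [binormal, cross_cross_right, lorentz_tangent_normal hγ hcurv,
    lorentz_normal_normal (hcurv t), one_smul, zero_smul, zero_sub]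

theorem hasDerivAt_deriv (t : ℝ) :
    HasDerivAt (deriv γ) ((speed γ t ^ 2 * curvature γ t) • normal γ t +
      deriv (speed γ) t • tangent γ t) t := by
  have hv := fun t => isSpacelike_deriv_of_isSpacelike_curvatureVector (hcurv t)
  have hspeed : ContDiff ℝ 1 (speed γ) := contDiff_speed hγ hv
  have heq : deriv γ = fun t => speed γ t • tangent γ t := funext fun t =>
    deriv_eq_speed_smul_arcDeriv (speed_pos_of_isSpacelike_curvatureVector (hcurv t)) γ
  rw [heq]
  refine ((hspeed.differentiable one_ne_zero t).hasDerivAt.smul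
    (hasDerivAt_tangent hγ hcurv t)).congr_deriv ?_
  rw [smul_smul, sq, mul_assoc]

theorem areaForm_shadow_deriv_ne_zero (t : ℝ) :
    Complex.orientation.areaForm (deriv (shadow ∘ γ) t) (deriv (deriv (shadow ∘ γ)) t) ≠ 0 := by
  have hshadow : deriv (shadow ∘ γ) = shadow ∘ deriv γ := funext fun t =>
    (shadow.hasFDerivAt.comp_hasDerivAt t (hγ.differentiable two_ne_zero t).hasDerivAt).deriv
  have hv := speed_pos_of_isSpacelike_curvatureVector (hcurv t)
  rw [hshadow, (shadow.hasFDerivAt.comp_hasDerivAt t (hasDerivAt_deriv hγ hcurv t)).deriv,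
    Function.comp_apply, deriv_eq_speed_smul_arcDeriv hv γ, ← tangent]
  have harea : Complex.orientation.areaForm (shadow (tangent γ t)) (shadow (normal γ t)) ≠ 0 := by
    rw [areaForm_shadow_shadow]
    exact neg_ne_zero.2 (binormal_time_ne_zero hγ hcurv t)
  have hκ : 0 < curvature γ t := Real.sqrt_pos.2 (hcurv t)
  simp only [map_add, map_smul, LinearMap.smul_apply, Orientation.areaForm_apply_self, smul_zero,
    add_zero]
  exact smul_ne_zero (by positivity) (smul_ne_zero hv.ne' harea)

end

section

variable (hγ : ContDiff ℝ 3 γ) (hcurv : ∀ t, IsSpacelike (curvatureVector γ t))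
include hγ hcurv

theorem lorentz_deriv_normal_normal (t : ℝ) : lorentz (deriv (normal γ) t) (normal γ t) = 0 := by
  have hN : HasDerivAt (normal γ) (deriv (normal γ) t) t :=
    ((contDiff_normal (n := 1) hγ hcurv).differentiable one_ne_zero t).hasDerivAt
  have hunit : (fun t => lorentz (normal γ t) (normal γ t)) = fun _ => 1 :=
    funext fun t => lorentz_normal_normal (hcurv t)
  have hderiv := (hunit ▸ hasDerivAt_lorentz hN hN).unique (hasDerivAt_const t 1)
  rw [lorentz_comm (normal γ t)] at hderiv
  linarith

theorem lorentz_deriv_normal_tangent (t : ℝ) :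
    lorentz (deriv (normal γ) t) (tangent γ t) = -(speed γ t * curvature γ t) := by
  have hγ2 : ContDiff ℝ 2 γ := hγ.of_le (by norm_num)
  have hN : HasDerivAt (normal γ) (deriv (normal γ) t) t :=
    ((contDiff_normal (n := 1) hγ hcurv).differentiable one_ne_zero t).hasDerivAt
  have horth : (fun t => lorentz (tangent γ t) (normal γ t)) = fun _ => 0 :=
    funext (lorentz_tangent_normal hγ2 hcurv)
  have hderiv := (horth ▸ hasDerivAt_lorentz (hasDerivAt_tangent hγ2 hcurv t) hN).unique
    (hasDerivAt_const t 0)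
  rw [lorentz_smul_left, lorentz_normal_normal (hcurv t), lorentz_comm (tangent γ t)] at hderiv
  linarith

theorem hasDerivAt_normal (t : ℝ) :
    HasDerivAt (normal γ) (-(speed γ t * curvature γ t) • tangent γ t +
      (speed γ t * torsion γ t) • binormal γ t) t := by
  have hv := speed_pos_of_isSpacelike_curvatureVector (hcurv t)
  have hN : HasDerivAt (normal γ) (deriv (normal γ) t) t :=
    ((contDiff_normal (n := 1) hγ hcurv).differentiable one_ne_zero t).hasDerivAt
  have hτ : speed γ t * torsion γ t = -lorentz (deriv (normal γ) t) (binormal γ t) := by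
    rw [torsion, mul_neg, ← lorentz_smul_left, ← deriv_eq_speed_smul_arcDeriv hv]
  have hframe := gram_smul_eq (tangent γ t) (normal γ t) (deriv (normal γ) t)
  rw [lorentz_tangent_normal (hγ.of_le (by norm_num)) hcurv, lorentz_normal_normal (hcurv t),
    lorentz_tangent_tangent (isSpacelike_deriv_of_isSpacelike_curvatureVector (hcurv t)),
    lorentz_deriv_normal_normal hγ hcurv, lorentz_deriv_normal_tangent hγ hcurv,
    ← binormal] at hframe
  refine hN.congr_deriv ?_
  rw [hτ]
  linear_combination (norm := module) hframe

theorem hasDerivAt_binormal (t : ℝ) :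
    HasDerivAt (binormal γ) ((speed γ t * torsion γ t) • normal γ t) t := by
  have hγ2 : ContDiff ℝ 2 γ := hγ.of_le (by norm_num)
  refine (hasDerivAt_cross (hasDerivAt_tangent hγ2 hcurv t)
    (hasDerivAt_normal hγ hcurv t)).congr_deriv ?_
  simp only [← crossL_apply, map_add, map_smul, smul_apply]
  simp only [crossL_apply, cross_self, cross_tangent_binormal hγ2 hcurv, smul_zero, zero_add,
    add_zero]

theorem hasDerivAt_osculatingHeight (p : R21) (t : ℝ) :
    HasDerivAt (osculatingHeight γ p)
      (torsion γ t * (Complex.orientation.areaForm (shadow (p - γ t)) (shadow (deriv γ t)) /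
        binormal γ t 2 ^ 2)) t := by
  have hγ2 : ContDiff ℝ 2 γ := hγ.of_le (by norm_num)
  have hv := speed_pos_of_isSpacelike_curvatureVector (hcurv t)
  have hB := hasDerivAt_binormal hγ hcurv t
  have hB2 : HasDerivAt (fun t => binormal γ t 2) (((speed γ t * torsion γ t) • normal γ t) 2) t :=
    (EuclideanSpace.proj 2 : R21 →L[ℝ] ℝ).hasFDerivAt.comp_hasDerivAt t hB
  have hp : HasDerivAt (fun t => p - γ t) (-deriv γ t) t :=
    (hγ2.differentiable two_ne_zero t).hasDerivAt.const_sub p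
  refine ((hasDerivAt_lorentz hB hp).div hB2 (binormal_time_ne_zero hγ2 hcurv t)).congr_deriv ?_
  have hnum := lorentz_mul_cross_sub (binormal γ t) (normal γ t) (p - γ t)
  rw [cross_normal_binormal hγ2 hcurv, map_neg, map_neg, neg_neg] at hnum
  have hBγ : lorentz (binormal γ t) (-deriv γ t) = 0 := by
    rw [← neg_one_smul ℝ, lorentz_smul_right, lorentz_binormal_deriv hv, mul_zero]
  rw [hBγ, zero_add, lorentz_smul_left, PiLp.smul_apply, smul_eq_mul,
    deriv_eq_speed_smul_arcDeriv hv γ, ← tangent, map_smul, map_smul, smul_eq_mul, ← hnum]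
  ring

theorem exists_plane_of_torsion_eq_zero (htors : ∀ t, torsion γ t = 0) :
    ∃ P : AffineSubspace ℝ R21, Module.finrank ℝ P.direction = 2 ∧ ∀ t, γ t ∈ P := by
  have hB : ∀ t, HasDerivAt (binormal γ) 0 t := fun t => by
    simpa only [htors, mul_zero, zero_smul] using hasDerivAt_binormal hγ hcurv t
  have hconst : ∀ t, binormal γ t = binormal γ 0 := fun t =>
    is_const_of_deriv_eq_zero (fun t => (hB t).differentiableAt) (fun t => (hB t).deriv) t 0
  have hd : ∀ t, HasDerivAt (fun t => lorentz (binormal γ 0) (γ t)) 0 t := fun t => by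
    refine ((lorentzL (binormal γ 0)).hasFDerivAt.comp_hasDerivAt t
      (hγ.differentiable three_ne_zero t).hasDerivAt).congr_deriv ?_
    rw [lorentzL_apply, ← hconst t,
      lorentz_binormal_deriv (speed_pos_of_isSpacelike_curvatureVector (hcurv t))]
  have hnorm := lorentz_binormal_binormal (hγ.of_le (by norm_num)) hcurv 0
  exact exists_plane_of_lorentz_eq (hnorm.trans_ne (by norm_num)) fun t =>
    is_const_of_deriv_eq_zero (fun t => (hd t).differentiableAt) (fun t => (hd t).deriv) t 0

theorem torsion_eq_zero_of_injOn_shadow {L : ℝ} (hL : 0 < L) (hper : Function.Periodic γ L)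
    (hinj : InjOn (shadow ∘ γ) (Ico 0 L))
    (htors : (∀ t, 0 ≤ torsion γ t) ∨ ∀ t, torsion γ t ≤ 0) (t : ℝ) : torsion γ t = 0 := by
  have hγ2 : ContDiff ℝ 2 γ := hγ.of_le (by norm_num)
  have hconvex := areaForm_deriv_sub_pos_or_neg (shadow.contDiff.comp hγ2)
    (fun t => congrArg shadow (hper t)) hL hinj (areaForm_shadow_deriv_ne_zero hγ2 hcurv)
  set a := t - L / 2 with ha
  have hdet : ∀ s, Complex.orientation.areaForm (shadow (γ a - γ s)) (shadow (deriv γ s)) =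
      -Complex.orientation.areaForm (deriv (shadow ∘ γ) s)
        ((shadow ∘ γ) (a + L) - (shadow ∘ γ) s) := fun s => by
    rw [Orientation.areaForm_swap, Function.comp_apply, Function.comp_apply, hper a, map_sub,
      (shadow.hasFDerivAt.comp_hasDerivAt s (hγ2.differentiable two_ne_zero s).hasDerivAt).deriv]
  have hB : ∀ s, 0 < binormal γ s 2 ^ 2 := fun s => by
    have := binormal_time_ne_zero hγ2 hcurv s
    positivity
  have hmem : ∀ s ∈ Ioo a (a + L), a + L ∈ Ioo s (s + L) := fun s hs =>
    ⟨hs.2, by linarith [hs.1]⟩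
  refine eq_zero_of_hasDerivAt_mul (hasDerivAt_osculatingHeight hγ hcurv (γ a)) (a := a)
    (b := a + L) ?_ htors (hconvex.symm.imp (fun h s hs => ?_) fun h s hs => ?_)
    ⟨by linarith, by linarith⟩
  · simp only [osculatingHeight, hper a, periodic_binormal hper a]
  · rw [hdet]
    exact div_pos (neg_pos.2 (h s _ (hmem s hs))) (hB s)
  · rw [hdet]
    exact div_neg_of_neg_of_pos (neg_neg_iff_pos.2 (h s _ (hmem s hs))) (hB s)

end

end Frenet

end Minkowski

end

theorem theorem2_general {M : Type*} [TopologicalSpace M] [T2Space M] [PreconnectedSpace M]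
    [ChartedSpace (EuclideanSpace ℝ (Fin 2)) M] [IsManifold (𝓡 2) 1 M]
    {F : M → Minkowski.R21} (hF : Minkowski.IsC1SpacelikeImmersion F)
    (hcomplete : Minkowski.IsCompleteInduced F) {γ : ℝ → Minkowski.R21} {L : ℝ} (hL : 0 < L)
    (hγ : ContDiff ℝ 3 γ) (hper : Function.Periodic γ L) (hinj : InjOn γ (Ico 0 L))
    (hγF : ∀ t, γ t ∈ range F) (hcurv : ∀ t, Minkowski.IsSpacelike (Minkowski.curvatureVector γ t))
    (htors : (∀ t, 0 ≤ Minkowski.torsion γ t) ∨ ∀ t, Minkowski.torsion γ t ≤ 0) :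
    (∀ t, Minkowski.torsion γ t = 0) ∧
      ∃ P : AffineSubspace ℝ Minkowski.R21,
        Module.finrank ℝ P.direction = 2 ∧ ∀ t, γ t ∈ P := by
  choose x hx using hγF
  have hshadow : InjOn (Minkowski.shadow ∘ γ) (Ico 0 L) := fun s hs t ht hst => hinj hs ht <| by
    have hxx : x s = x t := hF.injective_shadow_comp hcomplete (by
      simpa only [Function.comp_apply, hx] using hst)
    rw [← hx s, hxx, hx t]
  have hzero := Minkowski.torsion_eq_zero_of_injOn_shadow hγ hcurv hL hper hshadow htors
  exact ⟨hzero, Minkowski.exists_plane_of_torsion_eq_zero hγ hcurv hzero⟩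

theorem theorem2
    {M : Type*} [TopologicalSpace M] [T2Space M] [SecondCountableTopology M] [ConnectedSpace M]
    [ChartedSpace (EuclideanSpace ℝ (Fin 2)) M] [IsManifold (𝓡 2) ∞ M]
    (F : M → Minkowski.R21) (hF : Minkowski.IsSpacelikeImmersion F)
    (hcomplete : Minkowski.IsCompleteInduced F)
    (γ : ℝ → Minkowski.R21) (L : ℝ) (hγ : Minkowski.IsSmoothSimpleClosedCurve γ L)
    (hγF : ∀ t, γ t ∈ Set.range F)
    (hcurv : ∀ t, Minkowski.IsSpacelike (Minkowski.curvatureVector γ t))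
    (htors : (∀ t, 0 ≤ Minkowski.torsion γ t) ∨ (∀ t, Minkowski.torsion γ t ≤ 0)) :
    (∀ t, Minkowski.torsion γ t = 0) ∧
      ∃ P : AffineSubspace ℝ Minkowski.R21,
        Module.finrank ℝ P.direction = 2 ∧ ∀ t, γ t ∈ P :=
  have : IsManifold (𝓡 2) 1 M := .of_le (n := ∞) (by simp)
  theorem2_general ⟨hF.smooth.of_le (by simp), hF.spacelike⟩ hcomplete hγ.period_pos
    (contDiff_infty.1 hγ.smooth 3) hγ.periodic hγ.simple hγF hcurv htors
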